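/- **Setting.** Fix $T>0$, $\alpha\in(\tfrac13,\tfrac12]$, a separable real Banach space $V$ and nonnegative numbers $\boldsymbol\beta_2=(\beta_0,\beta_1,\beta_2)$. Write $\Phi_{s,t}=\Phi_t-\Phi_s$. A function $\Phi$ on $[0,T]$ is in $\mathcal C^\gamma$ if $\sup_{s\ne t}\|\Phi_{s,t}\|/|t-s|^\gamma<\infty$, and a function $\Psi$ on $[0,T]^2$ is in $\mathcal C^\gamma_2$ if $\sup_{s\neq t}\|\Psi_{s,t}\|/|t-s|^\gamma<\infty$. Let $V\otimes V$ be the (completed) projective tensor product; $\mathcal L(V;\mathcal L(V;E))$ is identified with $\mathcal L(V\otimes V;E)$ by $B(v\otimes w)=B(v)(w)$. A *linear rough path* $\mathbf X=(X,\mathbb X)\in\mathscr C^\alpha([0,T];V)$ consists of $X\in\mathcal C^\alpha([0,T];V)$ and $\mathbb X\in\mathcal C_2^{2\alpha}([0,T]^2;V\otimes V)$ with $\mathbb X_{s,t}-\mathbb X_{s,u}-\mathbb X_{u,t}=X_{s,u}\otimes X_{u,t}$ for all $s,u,t\in[0,T]$. Put $\langle X\rangle_{s,t}=X_{s,t}\otimes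 X_{s,t}-2\mathbb X_{s,t}$. For a Banach space $E$, $(Y,Y')\in\mathscr D_X^{2\alpha}(E)$ means that $Y\in\mathcal C^\alpha([0,T];E)$, $Y'\in\mathcal C^\alpha([0,T];\mathcal L(V;E))$ and $Y_{s,t}-Y'_s(X_{s,t})$ is in $\mathcal C^{2\alpha}_2([0,T]^2;E)$. For a two-parameter $\Xi$ and $s\le t$ let $\mathcal J_{s,t}(\Xi)=\lim_{|\pi|\to0}\sum_{k=1}^n\Xi_{t_{k-1},t_k}$ over partitions $\pi=(s=t_0<\dots<t_n=t)$, if the limit exists. Define $\int_s^tY_r\,d\mathbf X_r=\mathcal J_{s,t}(\Xi)$ with $\Xi_{u,v}=Y_u(X_{u,v})+Y'_u(\mathbb X_{u,v})$ for $(Y,Y')\in\mathscr D_X^{2\alpha}(\mathcal L(V;V))$ (linear rough integral), and $\int_s^tA_r\,d\langle X\rangle_r=\mathcal J_{s,t}(\Xi)$ with $\Xi_{u,v}=A_u(\langle X\rangle_{u,v})$ for $A:[0,T]\to\mathcal L(V\otimes V;V)$ (Young integral). Let $f\in\mathcal C^{3,\boldsymbol\beta_2}_{loc}(V^2;V)$: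 the partial Fréchet derivatives $D_2^kD_1^jf$ exist for $0\le j\le3$, $0\le k\le2$, and $\sup_{x\in K,\,y\in V}\|D_2^kD_1^jf(x,y)\|/(1+\|y\|)^{\beta_k}<\infty$ for every compact $K\subset V$. Write $D_{11}f=D_1D_1f$, $D_{21}f=D_2D_1f$, $D_{211}f=D_2D_1D_1f$, where the first vector argument of an iterated derivative is the direction of the outermost one. Let $W(t,x)=f(X_t,x)$, let $h^{x,y}(z)=D_{21}f(z,y)(f(z,x))\in\mathcal L(V;V)$, and $$\mathbb W_{s,t}(x,y)=\int_s^t h^{x,y}(X_r)\,d\mathbf X_r+\frac12\int_s^tD_{211}f(X_r,y)(f(X_r,x))\,d\langle X\rangle_r-\big(D_2f(X_t,y)-D_2f(X_s,y)\big)(f(X_s,x)),$$ where $h^{x,y}(X)$ is taken with Gubinelli derivative $Dh^{x,y}(X)$. Let $(Y,\dot Y)\in\mathscr E_W^{2\alpha}$, that is, $Y,\dot Y\in\mathcal C^\alpha([0,T];V)$ and $Y_{s,t}-\big(W(t,\dot Y_s)-W(s,\dot Y_s)\big)$ is in $\mathcal C^{2\alpha}_2([0,T]^2;V)$. The nonlinear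 rough integral is $\int_s^tW(dr,Y_r)=\mathcal J_{s,t}(\Xi)$ with $\Xi_{u,v}=W(v,Y_u)-W(u,Y_u)+\mathbb W_{u,v}(\dot Y_u,Y_u)$. **Theorem 5.1.** For all $x,y\in V$ the function $h^{x,y}$ is differentiable, $(h^{x,y}(X),Dh^{x,y}(X))\in\mathscr D_X^{2\alpha}(\mathcal L(V;V))$, and the limits defining the two integrals in $\mathbb W_{s,t}(x,y)$ exist for $0\le s\le t\le T$. Moreover $(Y,Y')\in\mathscr D_X^{2\alpha}(V)$ with $Y'=D_1f(X,\dot Y)$, and $D_1f(X,Y)$ is controlled by $X$ in $\mathscr D_X^{2\alpha}(\mathcal L(V;V))$ with Gubinelli derivative $v\mapsto D_{11}f(X,Y)(v)+D_{21}f(X,Y)(Y'v)$. For all $0\le s\le t\le T$ the limits defining the three integrals below exist, and $$\int_s^tW(dr,Y_r)=\int_s^tD_1f(X_r,Y_r)\,d\mathbf X_r+\frac12\int_s^tD_{11}f(X_r,Y_r)\,d\langle X\rangle_r .$$ The integral on the left is a nonlinear rough integral, the first on the right is a linear rough integral (with the Gubinelli derivative just given), and the last is a Young integral. -/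

import Mathlib

universe u

namespace NonlinearRough

noncomputable section

section Tensor

/-- The projective tensor product of `V` with itself: the completion of the algebraic
tensor product `⨂[ℝ] (_ : Fin 2), V`, which carries the projective norm
`‖z‖ = inf {∑ ‖vᵢ‖ ‖wᵢ‖ : z = ∑ vᵢ ⊗ wᵢ}`. -/
abbrev ProjTensor (V : Type u) [NormedAddCommGroup V] [NormedSpace ℝ V] : Type u :=
  UniformSpace.Completion (PiTensorProduct ℝ (fun _ : Fin 2 => V))

variable {V : Type u} [NormedAddCommGroup V] [NormedSpace ℝ V]
  {E : Type u} [NormedAddCommGroup E] [NormedSpace ℝ E]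

/-- The elementary tensor `v ⊗ w`. -/
def elemTensor (v w : V) : ProjTensor V :=
  ((PiTensorProduct.tprod ℝ ![v, w] : PiTensorProduct ℝ (fun _ : Fin 2 => V)) : ProjTensor V)

/-- The continuous bilinear map `(v, w) ↦ B v w` as a multilinear map in two variables. -/
def bilinToMultilin (B : V →L[ℝ] V →L[ℝ] E) :
    ContinuousMultilinearMap ℝ (fun _ : Fin 2 => V) E where
  toFun m := B (m 0) (m 1)
  map_update_add' m i x y := by fin_cases i <;> simp [Function.update]
  map_update_smul' m i c x := by fin_cases i <;> simp [Function.update]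
  cont := by
    change Continuous fun m : Fin 2 → V => B (m 0) (m 1)
    fun_prop

/-- The identification of `𝓛(V; 𝓛(V; E))` with `𝓛(V ⊗ V; E)`: the continuous linear map
on `V ⊗ V` that sends `v ⊗ w` to `B v w`. -/
def tensorLift [CompleteSpace E] (B : V →L[ℝ] V →L[ℝ] E) : ProjTensor V →L[ℝ] E :=
  (PiTensorProduct.liftIsometry ℝ (fun _ : Fin 2 => V) E (bilinToMultilin B)).extend
    (UniformSpace.Completion.toComplL (𝕜 := ℝ) (E := PiTensorProduct ℝ (fun _ : Fin 2 => V)))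

theorem tensorLift_elemTensor [CompleteSpace E] (B : V →L[ℝ] V →L[ℝ] E) (v w : V) :
    tensorLift B (elemTensor v w) = B v w := by
  have h := ContinuousLinearMap.extend_eq
    (PiTensorProduct.liftIsometry ℝ (fun _ : Fin 2 => V) E (bilinToMultilin B))
    (e := UniformSpace.Completion.toComplL (𝕜 := ℝ)
      (E := PiTensorProduct ℝ (fun _ : Fin 2 => V)))
    UniformSpace.Completion.denseRange_coe
    (UniformSpace.Completion.isUniformInducing_coe _) (PiTensorProduct.tprod ℝ ![v, w])
  rw [PiTensorProduct.liftIsometry_apply_apply, PiTensorProduct.lift.tprod] at h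
  exact h

end Tensor

section Holder

variable {E : Type u} [NormedAddCommGroup E]

/-- The increment `Φ_{s,t} = Φ_t - Φ_s`. -/
def incr (Φ : ℝ → E) (s t : ℝ) : E := Φ t - Φ s

/-- `Ψ ∈ 𝒞₂^γ([0,T]²; E)`: the two-parameter function `Ψ` has finite `γ`-Hölder seminorm. -/
def IsHolder₂ (T γ : ℝ) (Ψ : ℝ → ℝ → E) : Prop :=
  ∃ C : ℝ, ∀ s ∈ Set.Icc 0 T, ∀ t ∈ Set.Icc 0 T, s ≠ t → ‖Ψ s t‖ ≤ C * |t - s| ^ γ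

/-- `Φ ∈ 𝒞^γ([0,T]; E)`. -/
def IsHolder (T γ : ℝ) (Φ : ℝ → E) : Prop := IsHolder₂ T γ (incr Φ)

end Holder

section Limits

variable {E : Type u} [NormedAddCommGroup E]

/-- `I` is the limit, as `|π| → 0`, of the sums `∑_{k=1}^n Ξ_{t_{k-1},t_k}` over the partitions
`π = (s = t_0 < t_1 < ⋯ < t_n = t)` of `[s,t]`. -/
def HasSumLimit (Ξ : ℝ → ℝ → E) (s t : ℝ) (I : E) : Prop :=
  ∀ ε > 0, ∃ δ > 0, ∀ (n : ℕ) (τ : ℕ → ℝ), τ 0 = s → τ n = t →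
    (∀ k < n, τ k < τ (k + 1)) → (∀ k < n, τ (k + 1) - τ k < δ) →
    ‖∑ k ∈ Finset.range n, Ξ (τ k) (τ (k + 1)) - I‖ < ε

/-- The limit of the sums of `Ξ` over partitions of `[s,t]` exists. -/
def SumConverges (Ξ : ℝ → ℝ → E) (s t : ℝ) : Prop := ∃ I, HasSumLimit Ξ s t I

open Classical in
/-- `𝓙_{s,t}(Ξ)`, the limit of the sums of `Ξ` over partitions of `[s,t]` when `s ≤ t`
(with value `0` if there is no limit), and `𝓙_{s,t}(Ξ) = -𝓙_{t,s}(Ξ)` when `t < s`. -/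
def sumLimit (Ξ : ℝ → ℝ → E) (s t : ℝ) : E :=
  if s ≤ t then (if h : SumConverges Ξ s t then h.choose else 0)
  else -(if h : SumConverges Ξ t s then h.choose else 0)

end Limits

section LinearRoughPaths

variable {V : Type u} [NormedAddCommGroup V] [NormedSpace ℝ V]
  {E : Type u} [NormedAddCommGroup E] [NormedSpace ℝ E]

/-- `(X, XX) ∈ 𝒞^α([0,T]; V)`: `(X, XX)` is a (linear) `α`-Hölder rough path. -/
structure IsRoughPath (T α : ℝ) (X : ℝ → V) (XX : ℝ → ℝ → ProjTensor V) : Prop where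
  holder : IsHolder T α X
  holder₂ : IsHolder₂ T (2 * α) XX
  chen : ∀ s ∈ Set.Icc 0 T, ∀ u ∈ Set.Icc 0 T, ∀ t ∈ Set.Icc 0 T,
    XX s t - XX s u - XX u t = elemTensor (incr X s u) (incr X u t)

/-- `(Y, Y') ∈ 𝒟_X^{2α}(E)`: `Y` is controlled by `X` with Gubinelli derivative `Y'`. -/
structure IsControlled (T α : ℝ) (X : ℝ → V) (Y : ℝ → E) (Y' : ℝ → V →L[ℝ] E) : Prop where
  holder : IsHolder T α Y
  holder_deriv : IsHolder T α Y'
  remainder : IsHolder₂ T (2 * α) (fun s t => incr Y s t - Y' s (incr X s t))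

variable [CompleteSpace E]

/-- The compensated Riemann-Stieltjes summand `Y_s X_{s,t} + Y'_s 𝕏_{s,t}`. -/
def linearSummand (X : ℝ → V) (XX : ℝ → ℝ → ProjTensor V)
    (Y : ℝ → V →L[ℝ] E) (Y' : ℝ → V →L[ℝ] V →L[ℝ] E) (s t : ℝ) : E :=
  Y s (incr X s t) + tensorLift (Y' s) (XX s t)

/-- The linear rough integral `∫_s^t Y_r d𝐗_r` of `(Y, Y')` against `𝐗 = (X, XX)`. -/
def linearRoughIntegral (X : ℝ → V) (XX : ℝ → ℝ → ProjTensor V)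
    (Y : ℝ → V →L[ℝ] E) (Y' : ℝ → V →L[ℝ] V →L[ℝ] E) (s t : ℝ) : E :=
  sumLimit (linearSummand X XX Y Y') s t

/-- The quadratic compensator `⟨X⟩_{s,t} = X_{s,t} ⊗ X_{s,t} - 2 𝕏_{s,t}`. -/
def bracket (X : ℝ → V) (XX : ℝ → ℝ → ProjTensor V) (s t : ℝ) : ProjTensor V :=
  elemTensor (incr X s t) (incr X s t) - (2 : ℝ) • XX s t

/-- The Riemann-Stieltjes summand `A_s ⟨X⟩_{s,t}`. -/
def youngSummand (X : ℝ → V) (XX : ℝ → ℝ → ProjTensor V)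
    (A : ℝ → V →L[ℝ] V →L[ℝ] E) (s t : ℝ) : E :=
  tensorLift (A s) (bracket X XX s t)

/-- The Young integral `∫_s^t A_r d⟨X⟩_r`. -/
def youngIntegral (X : ℝ → V) (XX : ℝ → ℝ → ProjTensor V)
    (A : ℝ → V →L[ℝ] V →L[ℝ] E) (s t : ℝ) : E :=
  sumLimit (youngSummand X XX A) s t

end LinearRoughPaths

section NonlinearRoughPaths

variable {V : Type u} [NormedAddCommGroup V]

/-- `(Y, Ydot) ∈ ℰ_W^{2α}`: `(Y, Ydot)` is a basic nonlinear controlled rough path by `W`. -/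
structure IsNonlinearControlled (T α : ℝ) (W : ℝ → V → V) (Y Ydot : ℝ → V) : Prop where
  holder : IsHolder T α Y
  holder_dot : IsHolder T α Ydot
  remainder : IsHolder₂ T (2 * α)
    (fun s t => incr Y s t - (W t (Ydot s) - W s (Ydot s)))

/-- The summand `W_{s,t}(Y_s) + 𝕎_{s,t}(Ydot_s, Y_s)`. -/
def nonlinearSummand (W : ℝ → V → V) (WW : ℝ → ℝ → V → V → V) (Y Ydot : ℝ → V)
    (s t : ℝ) : V :=
  (W t (Y s) - W s (Y s)) + WW s t (Ydot s) (Y s)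

/-- The nonlinear rough integral `∫_s^t W(dr, Y_r)` of `(Y, Ydot)` against `(W, WW)`. -/
def nonlinearRoughIntegral (W : ℝ → V → V) (WW : ℝ → ℝ → V → V → V) (Y Ydot : ℝ → V)
    (s t : ℝ) : V :=
  sumLimit (nonlinearSummand W WW Y Ydot) s t

end NonlinearRoughPaths

section Composition

variable {V : Type u} [NormedAddCommGroup V] [NormedSpace ℝ V]
  {E : Type u} [NormedAddCommGroup E] [NormedSpace ℝ E]

/-- The partial Fréchet derivative `D₁ g` in the first argument. -/
def D₁ (g : V → V → E) (x y : V) : V →L[ℝ] E := fderiv ℝ (fun z => g z y) x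

/-- The partial Fréchet derivative `D₂ g` in the second argument. -/
def D₂ (g : V → V → E) (x y : V) : V →L[ℝ] E := fderiv ℝ (fun z => g x z) y

/-- On `K × V` for every compact `K`, the function `g(x,y)` is `O((1 + ‖y‖)^b)`. -/
def GrowthBound (b : ℝ) (g : V → V → E) : Prop :=
  ∀ K : Set V, IsCompact K → ∃ C : ℝ, ∀ x ∈ K, ∀ y : V, ‖g x y‖ ≤ C * (1 + ‖y‖) ^ b

/-- `g` is `n` times Fréchet differentiable in the second argument and `D₂^k g` satisfies the
growth bound with exponent `β_k`, for `k = 0, …, n`. -/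
def GrowthSnd : (n : ℕ) → (Fin (n + 1) → ℝ) → {E : Type u} → [NormedAddCommGroup E] →
    [NormedSpace ℝ E] → (V → V → E) → Prop
  | 0, β, _, _, _, g => GrowthBound (β 0) g
  | n + 1, β, _, _, _, g =>
      GrowthBound (β 0) g ∧ (∀ x, Differentiable ℝ (fun y => g x y)) ∧
        GrowthSnd n (fun k => β k.succ) (D₂ g)

/-- `f ∈ 𝒞_loc^{m,β_n}(V²; E)`: the derivatives `D₂^k D₁^j f`, for `j ≤ m` and `k ≤ n`, exist,
and `D₂^k D₁^j f(x,y)` is `O((1 + ‖y‖)^{β_k})` for `x` in any given compact set. -/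
def MemCloc : (m : ℕ) → (n : ℕ) → (Fin (n + 1) → ℝ) → {E : Type u} → [NormedAddCommGroup E] →
    [NormedSpace ℝ E] → (V → V → E) → Prop
  | 0, n, β, _, _, _, f => GrowthSnd n β f
  | m + 1, n, β, _, _, _, f =>
      GrowthSnd n β f ∧ (∀ y, Differentiable ℝ (fun x => f x y)) ∧ MemCloc m n β (D₁ f)

/-- `W(t,x) = f(X_t, x)`. -/
def compW (f : V → V → V) (X : ℝ → V) (t : ℝ) (x : V) : V := f (X t) x

/-- The function `h^{x,y}(z) = D₂₁f(z,y)(f(z,x))`, with values in `𝓛(V; V)`, where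
`D₂₁ f = D₂ D₁ f` and `D₂₁f(z,y)(a)(b)` is the derivative in the second argument in direction `a`
of the derivative in the first argument in direction `b`. -/
def compH (f : V → V → V) (x y z : V) : V →L[ℝ] V := D₂ (D₁ f) z y (f z x)

/-- The integrand `D₂₁₁f(X_r,y)(f(X_r,x))`, with values in `𝓛(V; 𝓛(V; V))`, where
`D₂₁₁ f = D₂ D₁ D₁ f`. -/
def compA (f : V → V → V) (X : ℝ → V) (x y : V) (r : ℝ) : V →L[ℝ] V →L[ℝ] V :=
  D₂ (D₁ (D₁ f)) (X r) y (f (X r) x)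

variable [CompleteSpace V]

/-- The integral `∫_s^t g(dr,y)(f(X_r,x))`, where `g(t,y) = D₂f(X_t,y)`, defined as
`∫_s^t h(X_r) d𝐗_r + ½ ∫_s^t D₂₁₁f(X_r,y)(f(X_r,x)) d⟨X⟩_r` with `h = h^{x,y}`; the path `h(X)` has
Gubinelli derivative `Dh(X)`. -/
def compIntegral (f : V → V → V) (X : ℝ → V) (XX : ℝ → ℝ → ProjTensor V) (s t : ℝ) (x y : V) :
    V :=
  linearRoughIntegral X XX (fun r => compH f x y (X r)) (fun r => fderiv ℝ (compH f x y) (X r)) s t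
    + (1 / 2 : ℝ) • youngIntegral X XX (compA f X x y) s t

/-- `𝕎_{s,t}(x,y) = ∫_s^t g(dr,y)(f(X_r,x)) - g_{s,t}(y)(f(X_s,x))`, where `g(t,y) = D₂f(X_t,y)`. -/
def compWW (f : V → V → V) (X : ℝ → V) (XX : ℝ → ℝ → ProjTensor V) (s t : ℝ) (x y : V) : V :=
  compIntegral f X XX s t x y - (D₂ f (X t) y - D₂ f (X s) y) (f (X s) x)

end Composition

end

end NonlinearRough

/-! Both sides are limits of sums of two-parameter summands, and sums of a quantity of order
$|t-s|^{3\alpha}$ vanish in the limit because $3\alpha>1$ (`hasSumLimit_of_norm_le`). So it suffices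
that the two right-hand sums converge and that the summands agree up to that order
(`LocallyRegular.exists_norm_nonlinearSummand_sub_le`); convergence on the left and the identity
then come together, with no separate sewing argument for the nonlinear integral.

For the comparison put $x=\dot Y_s$, $y=Y_s$, $w=f(X_s,x)$. Taylor gives $W_{s,t}(y)\approx
D_1f\,X_{s,t}+\frac12D_{11}f(X_{s,t},X_{s,t})$. By sewing (`AlmostAdditive.sumConverges`) the two
integrals in $\mathbb W$ may be replaced by their summands, while the increment of
$D_2f(\cdot,y)(w)$ is $D_{21}f(w)X_{s,t}+\frac12D_{211}f(w)(X_{s,t},X_{s,t})$ up to the same order.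
Since $Dh=D_{211}f(f)+D_{21}f(D_1f\,\cdot)$, inserting $\langle X\rangle=X\otimes X-2\mathbb X$
cancels every $D_{211}$ term and leaves $\mathbb W\approx D_{21}f(D_1f\,\cdot)\mathbb X$. Splitting
$\frac12D_{11}f(X\otimes X)=\frac12D_{11}f\langle X\rangle+D_{11}f\,\mathbb X$ produces the
right-hand summands.

Two analytic points remain. Derivatives are given only in the order $D_2^kD_1^j$, so the derivatives
of $D_2f$ and $D_{21}f$ in the first variable are obtained from bounds on rectangular increments
(`MemCloc.hasFDerivAt_D₂`, `MemCloc.hasFDerivAt_D₂₁`). And growth bounds on compact sets must become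
uniform bounds on a convex neighbourhood of the path (`GrowthBound.eventually_nhds`,
`exists_locallyRegular`). -/

namespace NonlinearRough

/-! ### The sewing lemma for almost additive two-parameter functions. -/

section Sewing

variable {E : Type u} [NormedAddCommGroup E]

/-- The constant of the sewing lemma with exponent `γ`. -/
noncomputable def sewingConst (γ : ℝ) : ℝ := 2 / (1 - 2 * (1 / 2 : ℝ) ^ γ)

theorem two_mul_half_rpow_lt_one {γ : ℝ} (hγ : 1 < γ) : 2 * (1 / 2 : ℝ) ^ γ < 1 := by
  have h : (1 / 2 : ℝ) ^ γ < (1 / 2 : ℝ) ^ (1 : ℝ) :=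
    Real.rpow_lt_rpow_of_exponent_gt (by norm_num) (by norm_num) hγ
  rw [Real.rpow_one] at h
  linarith

theorem sewingConst_pos {γ : ℝ} (hγ : 1 < γ) : 0 < sewingConst γ := by
  have := two_mul_half_rpow_lt_one hγ
  unfold sewingConst
  apply div_pos <;> linarith

/-- The fixed-point equation that closes the bisection induction: two pieces of at most half the
length, plus two additivity defects. -/
theorem sewingConst_eq {γ : ℝ} (hγ : 1 < γ) :
    2 * (sewingConst γ * (1 / 2 : ℝ) ^ γ) + 2 = sewingConst γ := by
  have := two_mul_half_rpow_lt_one hγ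
  unfold sewingConst
  have h : 1 - 2 * (1 / 2 : ℝ) ^ γ ≠ 0 := by linarith
  field_simp
  ring

/-- `Ξ` is almost additive on `[0,T]`: `‖Ξ_{s,t} - Ξ_{s,u} - Ξ_{u,t}‖ ≤ K |t - s|^γ`. -/
def AlmostAdditive (T γ K : ℝ) (Ξ : ℝ → ℝ → E) : Prop :=
  ∀ s u t, 0 ≤ s → s ≤ u → u ≤ t → t ≤ T → ‖Ξ s t - Ξ s u - Ξ u t‖ ≤ K * (t - s) ^ γ

theorem AlmostAdditive.diag {T γ K : ℝ} {Ξ : ℝ → ℝ → E} (h : AlmostAdditive T γ K Ξ)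
    (hγ : 1 < γ) {s : ℝ} (hs : 0 ≤ s) (hsT : s ≤ T) : Ξ s s = 0 := by
  have := h s s s hs le_rfl le_rfl hsT
  rw [sub_self, sub_self, zero_sub, norm_neg, Real.zero_rpow (by linarith), mul_zero] at this
  simpa using this

theorem mono_of_forall_le {n : ℕ} {τ : ℕ → ℝ} (hτ : ∀ k < n, τ k ≤ τ (k + 1)) {i j : ℕ}
    (hij : i ≤ j) (hj : j ≤ n) : τ i ≤ τ j := by
  induction j, hij using Nat.le_induction with
  | base => exact le_rfl
  | succ m _ ih => exact (ih (by omega)).trans (hτ m (by omega))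

/-- Sums of an almost additive `Ξ` over any partition of `[s,t]` are close to `Ξ_{s,t}`. -/
theorem AlmostAdditive.norm_sum_sub_le {T γ K : ℝ} {Ξ : ℝ → ℝ → E}
    (h : AlmostAdditive T γ K Ξ) (hγ : 1 < γ) (hK : 0 ≤ K) (n : ℕ) :
    ∀ τ : ℕ → ℝ, 0 ≤ τ 0 → τ n ≤ T → (∀ k < n, τ k ≤ τ (k + 1)) →
      ‖∑ k ∈ Finset.range n, Ξ (τ k) (τ (k + 1)) - Ξ (τ 0) (τ n)‖ ≤
        sewingConst γ * K * (τ n - τ 0) ^ γ := by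
  have hC := sewingConst_pos hγ
  induction n using Nat.strong_induction_on with
  | _ n ih =>
  intro τ h0 hT hτ
  rcases Nat.eq_zero_or_pos n with rfl | hn
  · simp [h.diag hγ h0 hT, Real.zero_rpow (by linarith : γ ≠ 0)]
  set m := (τ 0 + τ n) / 2 with hm
  have h0n : τ 0 ≤ τ n := mono_of_forall_le hτ (Nat.zero_le n) le_rfl
  -- Removing the cell that contains the midpoint leaves two shorter partitions, each of at most
  -- half the length, to which the induction hypothesis applies. Reinserting that cell costs the two
  -- defects `e3` and `e4`.
  obtain ⟨k, hkn, hk1, hk2⟩ : ∃ k < n, τ k ≤ m ∧ m ≤ τ (k + 1) := by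
    classical
    have hex : ∃ k, m ≤ τ (k + 1) ∧ k < n := ⟨n - 1, by
      rw [Nat.sub_add_cancel hn]; exact ⟨by linarith, by omega⟩⟩
    refine ⟨Nat.find hex, (Nat.find_spec hex).2, ?_, (Nat.find_spec hex).1⟩
    rcases Nat.eq_zero_or_pos (Nat.find hex) with h | h
    · rw [h]; linarith
    · have := Nat.find_min hex (Nat.sub_lt h one_pos)
      rw [Nat.sub_add_cancel (show 1 ≤ Nat.find hex from h)] at this
      have hlt := (Nat.find_spec hex).2
      by_contra hc
      exact this ⟨le_of_not_ge hc, by omega⟩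
  have ha : τ 0 ≤ τ k := mono_of_forall_le hτ (Nat.zero_le k) hkn.le
  have hb : τ (k + 1) ≤ τ n := mono_of_forall_le hτ hkn le_rfl
  have hab := hτ k hkn
  have e1 := ih k hkn τ h0 (by linarith) fun j hj => hτ j (by omega)
  have e2 := ih (n - (k + 1)) (by omega) (fun j => τ (k + 1 + j)) (by simp; linarith)
    (by rw [Nat.add_sub_cancel' hkn]; exact hT) fun j hj => hτ (k + 1 + j) (by omega)
  simp only [Nat.add_sub_cancel' (show k + 1 ≤ n from hkn), add_zero] at e2
  have hsum : ∑ j ∈ Finset.range n, Ξ (τ j) (τ (j + 1)) =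
      ∑ j ∈ Finset.range k, Ξ (τ j) (τ (j + 1)) + Ξ (τ k) (τ (k + 1)) +
      ∑ j ∈ Finset.range (n - (k + 1)), Ξ (τ (k + 1 + j)) (τ (k + 1 + (j + 1))) := by
    rw [← Finset.sum_range_succ (fun j => Ξ (τ j) (τ (j + 1)))]
    conv_lhs => rw [← Nat.add_sub_cancel' (show k + 1 ≤ n from hkn)]
    rw [Finset.sum_range_add]
    rfl
  have e3 := h (τ 0) (τ k) (τ n) h0 ha (hab.trans hb) hT
  have e4 := h (τ k) (τ (k + 1)) (τ n) (h0.trans ha) hab hb hT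
  have hhalf : ((τ n - τ 0) / 2) ^ γ = (τ n - τ 0) ^ γ * (1 / 2 : ℝ) ^ γ := by
    rw [← Real.mul_rpow (by linarith) (by norm_num)]; congr 1; ring
  have b1 : (τ k - τ 0) ^ γ ≤ (τ n - τ 0) ^ γ * (1 / 2 : ℝ) ^ γ := by
    rw [← hhalf]
    exact Real.rpow_le_rpow (by linarith) (by linarith) (by linarith)
  have b2 : (τ n - τ (k + 1)) ^ γ ≤ (τ n - τ 0) ^ γ * (1 / 2 : ℝ) ^ γ := by
    rw [← hhalf]
    exact Real.rpow_le_rpow (by linarith) (by linarith) (by linarith)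
  have b4 : (τ n - τ k) ^ γ ≤ (τ n - τ 0) ^ γ :=
    Real.rpow_le_rpow (by linarith) (by linarith) (by linarith)
  have hCK : 0 ≤ sewingConst γ * K := by positivity
  have c1 := mul_le_mul_of_nonneg_left b1 hCK
  have c2 := mul_le_mul_of_nonneg_left b2 hCK
  have c4 := mul_le_mul_of_nonneg_left b4 hK
  have key : ∑ j ∈ Finset.range n, Ξ (τ j) (τ (j + 1)) - Ξ (τ 0) (τ n) =
      (∑ j ∈ Finset.range k, Ξ (τ j) (τ (j + 1)) - Ξ (τ 0) (τ k)) +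
      (∑ j ∈ Finset.range (n - (k + 1)), Ξ (τ (k + 1 + j)) (τ (k + 1 + (j + 1))) -
        Ξ (τ (k + 1)) (τ n)) - (Ξ (τ 0) (τ n) - Ξ (τ 0) (τ k) - Ξ (τ k) (τ n)) -
      (Ξ (τ k) (τ n) - Ξ (τ k) (τ (k + 1)) - Ξ (τ (k + 1)) (τ n)) := by
    rw [hsum]; abel
  rw [key]
  have htri := (norm_sub_le ((∑ j ∈ Finset.range k, Ξ (τ j) (τ (j + 1)) - Ξ (τ 0) (τ k)) +
      (∑ j ∈ Finset.range (n - (k + 1)), Ξ (τ (k + 1 + j)) (τ (k + 1 + (j + 1))) -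
        Ξ (τ (k + 1)) (τ n)) - (Ξ (τ 0) (τ n) - Ξ (τ 0) (τ k) - Ξ (τ k) (τ n)))
      (Ξ (τ k) (τ n) - Ξ (τ k) (τ (k + 1)) - Ξ (τ (k + 1)) (τ n))).trans
    (add_le_add_left ((norm_sub_le _ _).trans (add_le_add_left (norm_add_le _ _) _)) _)
  have hfin : sewingConst γ * K * (τ n - τ 0) ^ γ =
      2 * (sewingConst γ * K * ((τ n - τ 0) ^ γ * (1 / 2 : ℝ) ^ γ)) +
        2 * (K * (τ n - τ 0) ^ γ) := by
    conv_lhs => rw [← sewingConst_eq hγ]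
    ring
  linarith

theorem sum_range_two_mul (a : ℕ → E) (m : ℕ) :
    ∑ k ∈ Finset.range (2 * m), a k = ∑ k ∈ Finset.range m, (a (2 * k) + a (2 * k + 1)) := by
  induction m with
  | zero => simp
  | succ m ih =>
    rw [Finset.sum_range_succ _ m, ← ih, show 2 * (m + 1) = 2 * m + 1 + 1 by ring,
      Finset.sum_range_succ, Finset.sum_range_succ, add_assoc]

/-- The sum of `Ξ` over the dyadic grid of order `n` on `[0,T]`, stopped at `t`. -/
noncomputable def dyadicSum (T : ℝ) (Ξ : ℝ → ℝ → E) (n : ℕ) (t : ℝ) : E :=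
  ∑ k ∈ Finset.range (2 ^ n),
    Ξ (min ((k : ℝ) * (T / 2 ^ n)) t) (min (((k + 1 : ℕ) : ℝ) * (T / 2 ^ n)) t)

/-- The total of $2^n$ cell defects, written as a geometric sequence, whose ratio is below 1 when
$\gamma>1$. -/
theorem pow_two_mul_rpow {T γ : ℝ} (hT : 0 ≤ T) (n : ℕ) :
    (2 : ℝ) ^ n * (T / 2 ^ n) ^ γ = T ^ γ * (2 * (1 / 2 : ℝ) ^ γ) ^ n := by
  rw [div_eq_mul_one_div, Real.mul_rpow hT (by positivity), mul_pow, ← one_div_pow,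
    ← Real.rpow_natCast ((1 / 2 : ℝ) ^ γ), ← Real.rpow_mul (by norm_num), mul_comm γ,
    Real.rpow_mul (by norm_num), Real.rpow_natCast]
  ring

/-- Refining the grid halves each cell, so the difference is one additivity defect per cell;
stopping at $t$ only shortens cells. -/
theorem AlmostAdditive.norm_dyadicSum_succ_sub_le {T γ K : ℝ} {Ξ : ℝ → ℝ → E}
    (h : AlmostAdditive T γ K Ξ) (hγ : 1 < γ) (hK : 0 ≤ K) (hT : 0 ≤ T) {t : ℝ} (ht : 0 ≤ t)
    (htT : t ≤ T) (n : ℕ) :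
    ‖dyadicSum T Ξ (n + 1) t - dyadicSum T Ξ n t‖ ≤
      K * T ^ γ * (2 * (1 / 2 : ℝ) ^ γ) ^ n := by
  unfold dyadicSum
  rw [pow_succ' 2 n, sum_range_two_mul, ← Finset.sum_sub_distrib]
  have hd : 0 ≤ T / 2 ^ n := by positivity
  refine (norm_sum_le_of_le (Finset.range (2 ^ n)) (f := _)
    (n := fun _ => K * (T / 2 ^ n) ^ γ) fun k _ => ?_).trans ?_
  · have g0 : ((2 * k : ℕ) : ℝ) * (T / (2 * 2 ^ n)) = k * (T / 2 ^ n) := by push_cast; field_simp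
    have g2 : ((2 * k + 1 + 1 : ℕ) : ℝ) * (T / (2 * 2 ^ n)) = ((k + 1 : ℕ) : ℝ) * (T / 2 ^ n) := by
      push_cast; field_simp; ring
    have g1 : ((2 * k + 1 : ℕ) : ℝ) * (T / (2 * 2 ^ n)) = (k + 1 / 2) * (T / 2 ^ n) := by
      push_cast; field_simp
    rw [pow_succ' (2 : ℝ) n, g0, g1, g2]
    set a := (k : ℝ) * (T / 2 ^ n) with ha
    have ha0 : 0 ≤ a := by positivity
    have hb : (k + 1 / 2) * (T / 2 ^ n) = a + 1 / 2 * (T / 2 ^ n) := by rw [ha]; ring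
    have hc : ((k + 1 : ℕ) : ℝ) * (T / 2 ^ n) = a + T / 2 ^ n := by rw [ha]; push_cast; ring
    rw [hb, hc]
    have := h (min a t) (min (a + 1 / 2 * (T / 2 ^ n)) t) (min (a + T / 2 ^ n) t) (by positivity)
      (min_le_min_right _ (by linarith)) (min_le_min_right _ (by linarith))
      ((min_le_right _ _).trans htT)
    rw [← norm_neg, neg_sub, ← sub_sub]
    refine this.trans (mul_le_mul_of_nonneg_left (Real.rpow_le_rpow ?_ ?_ (by linarith)) hK)
    · exact sub_nonneg.2 (min_le_min_right _ (by linarith))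
    · rcases le_total a t with h1 | h1
      · rw [min_eq_left h1]; linarith [min_le_left (a + T / 2 ^ n) t]
      · rw [min_eq_right h1, min_eq_right (by linarith)]; linarith
  · rw [Finset.sum_const, Finset.card_range, nsmul_eq_mul, mul_assoc K, ← pow_two_mul_rpow hT]
    push_cast
    exact le_of_eq (by ring)

/-- The difference of the sums stopped at $t$ and at $s$ is nearly the sum over the grid clipped to
$[s,t]$, which is close to $\Xi_{s,t}$ by the bound for arbitrary partitions. The last term on the
right pays for the clipping and vanishes as $n\to\infty$. -/
theorem AlmostAdditive.norm_dyadicSum_sub_le {T γ K : ℝ} {Ξ : ℝ → ℝ → E}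
    (h : AlmostAdditive T γ K Ξ) (hγ : 1 < γ) (hK : 0 ≤ K) {s t : ℝ} (hs : 0 ≤ s)
    (hst : s ≤ t) (htT : t ≤ T) (n : ℕ) :
    ‖dyadicSum T Ξ n t - dyadicSum T Ξ n s - Ξ s t‖ ≤
      sewingConst γ * K * (t - s) ^ γ + K * T ^ γ * (2 * (1 / 2 : ℝ) ^ γ) ^ n := by
  have hT : 0 ≤ T := hs.trans (hst.trans htT)
  set σ : ℕ → ℝ := fun k => max s (min ((k : ℝ) * (T / 2 ^ n)) t) with hσ
  have hd : 0 ≤ T / 2 ^ n := by positivity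
  have hσ0 : σ 0 = s := by simp [hσ, hs.trans hst, hs]
  have hσn : σ (2 ^ n) = t := by
    have : ((2 ^ n : ℕ) : ℝ) * (T / 2 ^ n) = T := by push_cast; field_simp
    simp only [hσ]
    rw [this, min_eq_right htT, max_eq_right hst]
  have hmono : ∀ k < 2 ^ n, σ k ≤ σ (k + 1) := fun k _ => by
    apply max_le_max_left
    apply min_le_min_right
    push_cast
    nlinarith
  have e1 := h.norm_sum_sub_le hγ hK (2 ^ n) σ (hσ0.symm ▸ hs) (hσn.symm ▸ htT) hmono
  rw [hσ0, hσn] at e1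
  have e2 : ‖dyadicSum T Ξ n t - dyadicSum T Ξ n s -
      ∑ k ∈ Finset.range (2 ^ n), Ξ (σ k) (σ (k + 1))‖ ≤
      K * T ^ γ * (2 * (1 / 2 : ℝ) ^ γ) ^ n := by
    unfold dyadicSum
    rw [← Finset.sum_sub_distrib, ← Finset.sum_sub_distrib]
    refine (norm_sum_le_of_le (Finset.range (2 ^ n)) (f := _)
      (n := fun _ => K * (T / 2 ^ n) ^ γ) fun k _ => ?_).trans ?_
    · simp only [hσ]
      set a := (k : ℝ) * (T / 2 ^ n) with ha
      have ha0 : 0 ≤ a := by positivity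
      have hc : ((k + 1 : ℕ) : ℝ) * (T / 2 ^ n) = a + T / 2 ^ n := by rw [ha]; push_cast; ring
      rw [hc]
      have hnn : 0 ≤ K * (T / 2 ^ n) ^ γ := by positivity
      have dS := h.diag hγ hs (hst.trans htT)
      -- Cells to the right or to the left of $s$ contribute nothing, as $\Xi$ vanishes on the
      -- diagonal; a cell straddling $s$ contributes the defect of splitting it at $s$.
      rcases le_total s a with h1 | h1
      · rw [min_eq_right (b := s) h1, min_eq_right (b := s) (by linarith), dS,
          max_eq_right (le_min h1 hst), max_eq_right (le_min (by linarith) hst)]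
        simpa using hnn
      · rcases le_total (a + T / 2 ^ n) s with h2 | h2
        · rw [min_eq_left h1, min_eq_left h2, min_eq_left (h1.trans hst),
            min_eq_left (h2.trans hst), max_eq_left h1, max_eq_left h2, dS]
          simpa using hnn
        · rw [min_eq_left h1, min_eq_right h2, min_eq_left (h1.trans hst), max_eq_left h1,
            max_eq_right (le_min h2 hst)]
          have hm := le_min h2 hst
          refine (h a s _ ha0 h1 hm ((min_le_right _ _).trans htT)).trans
            (mul_le_mul_of_nonneg_left (Real.rpow_le_rpow (by linarith) ?_ (by linarith)) hK)
          linarith [min_le_left (a + T / 2 ^ n) t]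
    · rw [Finset.sum_const, Finset.card_range, nsmul_eq_mul, mul_assoc K, ← pow_two_mul_rpow hT]
      push_cast
      exact le_of_eq (by ring)
  calc _ = ‖(∑ k ∈ Finset.range (2 ^ n), Ξ (σ k) (σ (k + 1)) - Ξ s t) +
      (dyadicSum T Ξ n t - dyadicSum T Ξ n s -
        ∑ k ∈ Finset.range (2 ^ n), Ξ (σ k) (σ (k + 1)))‖ := by congr 1; abel
    _ ≤ _ := norm_add_le_of_le e1 e2

/-- The sewing lemma: an almost additive `Ξ` is close to the increments of a path. -/
theorem AlmostAdditive.exists_path [CompleteSpace E] {T γ K : ℝ} {Ξ : ℝ → ℝ → E}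
    (h : AlmostAdditive T γ K Ξ) (hγ : 1 < γ) (hK : 0 ≤ K) (hT : 0 ≤ T) :
    ∃ J : ℝ → E, ∀ s t, 0 ≤ s → s ≤ t → t ≤ T →
      ‖J t - J s - Ξ s t‖ ≤ sewingConst γ * K * (t - s) ^ γ := by
  have hlt := two_mul_half_rpow_lt_one hγ
  have hex : ∀ t, ∃ l, 0 ≤ t → t ≤ T →
      Filter.Tendsto (fun n => dyadicSum T Ξ n t) Filter.atTop (nhds l) := by
    intro t
    by_cases ht : 0 ≤ t ∧ t ≤ T
    · have hc : CauchySeq fun n => dyadicSum T Ξ n t :=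
        cauchySeq_of_le_geometric _ (K * T ^ γ) hlt fun n => by
          rw [dist_comm, dist_eq_norm]
          exact h.norm_dyadicSum_succ_sub_le hγ hK hT ht.1 ht.2 n
      obtain ⟨l, hl⟩ := cauchySeq_tendsto_of_complete hc
      exact ⟨l, fun _ _ => hl⟩
    · exact ⟨0, fun h1 h2 => (ht ⟨h1, h2⟩).elim⟩
  choose J hJ using hex
  refine ⟨J, fun s t hs hst htT => ?_⟩
  have l1 := (((hJ t (hs.trans hst) htT).sub (hJ s hs (hst.trans htT))).sub_const (Ξ s t)).norm
  have l2 : Filter.Tendsto (fun n : ℕ => sewingConst γ * K * (t - s) ^ γ +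
      K * T ^ γ * (2 * (1 / 2 : ℝ) ^ γ) ^ n) Filter.atTop
      (nhds (sewingConst γ * K * (t - s) ^ γ + K * T ^ γ * 0)) :=
    ((tendsto_pow_atTop_nhds_zero_of_lt_one (by positivity) hlt).const_mul _).const_add _
  rw [mul_zero, add_zero] at l2
  exact le_of_tendsto_of_tendsto' l1 l2 fun n => h.norm_dyadicSum_sub_le hγ hK hs hst htT n

end Sewing

/-! ### Limits of sums over partitions. -/

section SumLimit

variable {E : Type u} [NormedAddCommGroup E]

/-- Each term is at most $|M|\,\delta^{\gamma-1}$ times the cell length; the lengths telescope and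
$\delta^{\gamma-1}\to0$. -/
theorem hasSumLimit_of_norm_le {T γ M : ℝ} (hγ : 1 < γ) {Ξ : ℝ → ℝ → E}
    (h : ∀ s t, 0 ≤ s → s ≤ t → t ≤ T → ‖Ξ s t‖ ≤ M * (t - s) ^ γ) {s t : ℝ} (hs : 0 ≤ s)
    (ht : t ≤ T) : HasSumLimit Ξ s t 0 := by
  intro ε hε
  obtain ⟨δ, hδ, hδε⟩ : ∃ δ > 0, |M| * δ ^ (γ - 1) * |t - s| < ε := by
    have hc : Filter.Tendsto (fun δ : ℝ => |M| * δ ^ (γ - 1) * |t - s|) (nhds 0) (nhds 0) := by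
      have : ContinuousAt (fun δ : ℝ => |M| * δ ^ (γ - 1) * |t - s|) 0 := by
        have := Real.continuousAt_rpow_const 0 (γ - 1) (Or.inr (by linarith))
        fun_prop
      simpa [ContinuousAt, Real.zero_rpow (by linarith : γ - 1 ≠ 0)] using this
    have := (hc.eventually (gt_mem_nhds hε)).filter_mono
      (nhdsWithin_le_nhds (s := Set.Ioi (0 : ℝ)))
    obtain ⟨δ, h1, h2⟩ := (this.and self_mem_nhdsWithin).exists
    exact ⟨δ, h2, h1⟩
  refine ⟨δ, hδ, fun n τ h0 hn hmono hmesh => ?_⟩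
  have hmono' : ∀ k < n, τ k ≤ τ (k + 1) := fun k hk => (hmono k hk).le
  rw [sub_zero]
  have hst : s ≤ t := by rw [← h0, ← hn]; exact mono_of_forall_le hmono' (Nat.zero_le n) le_rfl
  refine lt_of_le_of_lt (norm_sum_le_of_le (Finset.range n)
    (n := fun k => |M| * δ ^ (γ - 1) * (τ (k + 1) - τ k)) fun k hk => ?_) ?_
  · have hk' := Finset.mem_range.1 hk
    have hpos := sub_pos.2 (hmono k hk')
    have h1 := h (τ k) (τ (k + 1))
      (hs.trans (h0 ▸ mono_of_forall_le hmono' (Nat.zero_le k) hk'.le)) (hmono' k hk')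
      ((hn ▸ mono_of_forall_le hmono' hk' le_rfl).trans ht)
    have h2 : (τ (k + 1) - τ k) ^ γ = (τ (k + 1) - τ k) ^ (γ - 1) * (τ (k + 1) - τ k) := by
      rw [← Real.rpow_add_one hpos.ne', sub_add_cancel]
    have h3 : (τ (k + 1) - τ k) ^ (γ - 1) ≤ δ ^ (γ - 1) :=
      Real.rpow_le_rpow hpos.le (hmesh k hk').le (by linarith)
    calc _ ≤ |M| * (τ (k + 1) - τ k) ^ γ :=
          h1.trans (mul_le_mul_of_nonneg_right (le_abs_self M) (by positivity))
      _ ≤ _ := by rw [h2, ← mul_assoc]; gcongr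
  · rw [← Finset.mul_sum, Finset.sum_range_sub, hn, h0, ← abs_of_nonneg (sub_nonneg.2 hst)]
    exact hδε

theorem hasSumLimit_incr (J : ℝ → E) (s t : ℝ) : HasSumLimit (incr J) s t (incr J s t) := by
  intro ε hε
  refine ⟨1, one_pos, fun n τ h0 hn _ _ => ?_⟩
  simp only [incr]
  rw [Finset.sum_range_sub (fun k => J (τ k)), hn, h0]
  simpa using hε

theorem HasSumLimit.add {Ξ Ξ' : ℝ → ℝ → E} {s t : ℝ} {I I' : E} (h : HasSumLimit Ξ s t I)
    (h' : HasSumLimit Ξ' s t I') :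
    HasSumLimit (fun u v => Ξ u v + Ξ' u v) s t (I + I') := by
  intro ε hε
  obtain ⟨δ, hδ, H⟩ := h (ε / 2) (half_pos hε)
  obtain ⟨δ', hδ', H'⟩ := h' (ε / 2) (half_pos hε)
  refine ⟨min δ δ', lt_min hδ hδ', fun n τ h0 hn hm hs => ?_⟩
  have e := H n τ h0 hn hm fun k hk => (hs k hk).trans_le (min_le_left _ _)
  have e' := H' n τ h0 hn hm fun k hk => (hs k hk).trans_le (min_le_right _ _)
  rw [Finset.sum_add_distrib, add_sub_add_comm]
  exact (norm_add_le _ _).trans_lt (by linarith)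

theorem HasSumLimit.const_smul [NormedSpace ℝ E] {Ξ : ℝ → ℝ → E} {s t : ℝ} {I : E}
    (h : HasSumLimit Ξ s t I) (c : ℝ) : HasSumLimit (fun u v => c • Ξ u v) s t (c • I) := by
  intro ε hε
  have hc : 0 < |c| + 1 := by positivity
  obtain ⟨δ, hδ, H⟩ := h (ε / (|c| + 1)) (div_pos hε hc)
  refine ⟨δ, hδ, fun n τ h0 hn hm hs => ?_⟩
  have e := H n τ h0 hn hm hs
  rw [← Finset.smul_sum, ← smul_sub, norm_smul, Real.norm_eq_abs]
  rw [lt_div_iff₀ hc] at e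
  nlinarith [norm_nonneg (∑ k ∈ Finset.range n, Ξ (τ k) (τ (k + 1)) - I)]

/-- Equidistant partitions realise every mesh. For $t<s$ there are no partitions and every value
would be a limit, hence the hypothesis $s\le t$. -/
theorem HasSumLimit.unique {Ξ : ℝ → ℝ → E} {s t : ℝ} (hst : s ≤ t) {I I' : E}
    (h : HasSumLimit Ξ s t I) (h' : HasSumLimit Ξ s t I') : I = I' := by
  refine eq_of_sub_eq_zero (norm_le_zero_iff.1 (le_of_forall_pos_lt_add fun ε hε => ?_))
  obtain ⟨δ, hδ, H⟩ := h (ε / 2) (half_pos hε)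
  obtain ⟨δ', hδ', H'⟩ := h' (ε / 2) (half_pos hε)
  obtain ⟨n, τ, h0, hn, hm, hs⟩ : ∃ (n : ℕ) (τ : ℕ → ℝ), τ 0 = s ∧ τ n = t ∧
      (∀ k < n, τ k < τ (k + 1)) ∧ ∀ k < n, τ (k + 1) - τ k < min δ δ' := by
    rcases hst.eq_or_lt with rfl | hlt
    · exact ⟨0, fun _ => s, rfl, rfl, by simp, by simp⟩
    · obtain ⟨n, hn⟩ := exists_nat_gt ((t - s) / min δ δ')
      have hd : 0 < min δ δ' := lt_min hδ hδ'
      have hn0 : (0 : ℝ) < n := lt_of_le_of_lt (div_nonneg (by linarith) hd.le) hn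
      have hstep : ∀ k : ℕ, s + ((k + 1 : ℕ) : ℝ) * ((t - s) / n) - (s + (k : ℝ) * ((t - s) / n))
          = (t - s) / n := fun k => by push_cast; ring
      refine ⟨n, fun k => s + (k : ℝ) * ((t - s) / n), by simp, by field_simp; ring,
        fun k _ => ?_, fun k _ => ?_⟩
      · rw [← sub_pos, hstep]
        exact div_pos (by linarith) hn0
      · rw [hstep, div_lt_iff₀ hn0]
        rw [div_lt_iff₀ hd] at hn
        linarith
  have e := H n τ h0 hn hm fun k hk => (hs k hk).trans_le (min_le_left _ _)
  have e' := H' n τ h0 hn hm fun k hk => (hs k hk).trans_le (min_le_right _ _)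
  have : I - I' = (∑ k ∈ Finset.range n, Ξ (τ k) (τ (k + 1)) - I') -
    (∑ k ∈ Finset.range n, Ξ (τ k) (τ (k + 1)) - I) := by abel
  rw [this]
  exact (norm_sub_le _ _).trans_lt (by linarith)

theorem HasSumLimit.sumLimit_eq {Ξ : ℝ → ℝ → E} {s t : ℝ} (hst : s ≤ t) {I : E}
    (h : HasSumLimit Ξ s t I) : sumLimit Ξ s t = I := by
  have hex : SumConverges Ξ s t := ⟨I, h⟩
  rw [sumLimit, if_pos hst, dif_pos hex]
  exact hex.choose_spec.unique hst h

theorem SumConverges.hasSumLimit {Ξ : ℝ → ℝ → E} {s t : ℝ} (hst : s ≤ t)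
    (h : SumConverges Ξ s t) : HasSumLimit Ξ s t (sumLimit Ξ s t) := by
  obtain ⟨I, hI⟩ := h
  rwa [hI.sumLimit_eq hst]

/-- The limit of the sums of an almost additive `Ξ` exists, and is close to `Ξ_{s,t}`. -/
theorem AlmostAdditive.sumConverges [CompleteSpace E] {T γ K : ℝ} {Ξ : ℝ → ℝ → E}
    (h : AlmostAdditive T γ K Ξ) (hγ : 1 < γ) (hK : 0 ≤ K) {s t : ℝ} (hs : 0 ≤ s)
    (hst : s ≤ t) (ht : t ≤ T) :
    SumConverges Ξ s t ∧ ‖sumLimit Ξ s t - Ξ s t‖ ≤ sewingConst γ * K * (t - s) ^ γ := by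
  obtain ⟨J, hJ⟩ := h.exists_path hγ hK (hs.trans (hst.trans ht))
  -- $\Xi$ differs from the increments of the sewn path by order $\gamma>1$, and sums of increments
  -- telescope exactly.
  have h0 : HasSumLimit (fun u v => Ξ u v - incr J u v) s t 0 :=
    hasSumLimit_of_norm_le (M := sewingConst γ * K) (T := T) hγ (fun u v hu huv hv => by
      rw [norm_sub_rev]; exact hJ u v hu huv hv) hs ht
  have h1 := h0.add (hasSumLimit_incr J s t)
  simp only [sub_add_cancel, zero_add] at h1
  refine ⟨⟨_, h1⟩, ?_⟩
  rw [h1.sumLimit_eq hst]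
  exact hJ s t hs hst ht

end SumLimit

/-! ### Bilinear maps as operators on the projective tensor product. -/

section TensorLift

variable {V : Type u} [NormedAddCommGroup V] [NormedSpace ℝ V]
  {E : Type u} [NormedAddCommGroup E] [NormedSpace ℝ E]

theorem bilinToMultilin_add (B C : V →L[ℝ] V →L[ℝ] E) :
    bilinToMultilin (B + C) = bilinToMultilin B + bilinToMultilin C := rfl

theorem norm_bilinToMultilin_le (B : V →L[ℝ] V →L[ℝ] E) : ‖bilinToMultilin B‖ ≤ ‖B‖ := by
  refine ContinuousMultilinearMap.opNorm_le_bound (norm_nonneg B) fun m => ?_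
  rw [Fin.prod_univ_two, ← mul_assoc]
  exact B.le_opNorm₂ (m 0) (m 1)

variable [CompleteSpace E]

theorem tensorLift_coe (B : V →L[ℝ] V →L[ℝ] E) (z : PiTensorProduct ℝ (fun _ : Fin 2 => V)) :
    tensorLift B (z : ProjTensor V) =
      PiTensorProduct.liftIsometry ℝ (fun _ : Fin 2 => V) E (bilinToMultilin B) z :=
  ContinuousLinearMap.extend_eq
    (PiTensorProduct.liftIsometry ℝ (fun _ : Fin 2 => V) E (bilinToMultilin B))
    (e := UniformSpace.Completion.toComplL (𝕜 := ℝ)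
      (E := PiTensorProduct ℝ (fun _ : Fin 2 => V)))
    UniformSpace.Completion.denseRange_coe
    (UniformSpace.Completion.isUniformInducing_coe _) z

theorem tensorLift_add (B C : V →L[ℝ] V →L[ℝ] E) (z : ProjTensor V) :
    tensorLift (B + C) z = tensorLift B z + tensorLift C z := by
  induction z using UniformSpace.Completion.induction_on with
  | hp => exact isClosed_eq (by fun_prop) (by fun_prop)
  | ih z =>
    simp only [tensorLift_coe, bilinToMultilin_add, map_add, add_apply]

theorem tensorLift_sub (B C : V →L[ℝ] V →L[ℝ] E) (z : ProjTensor V) :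
    tensorLift (B - C) z = tensorLift B z - tensorLift C z := by
  rw [eq_sub_iff_add_eq, ← tensorLift_add, sub_add_cancel]

/-- The projective norm makes the lift isometric on algebraic tensors, and the inequality passes to
the completion by density. -/
theorem norm_tensorLift_apply_le (B : V →L[ℝ] V →L[ℝ] E) (z : ProjTensor V) :
    ‖tensorLift B z‖ ≤ ‖B‖ * ‖z‖ := by
  induction z using UniformSpace.Completion.induction_on with
  | hp => exact isClosed_le (by fun_prop) (by fun_prop)
  | ih z =>
    rw [tensorLift_coe, UniformSpace.Completion.norm_coe]
    refine (ContinuousLinearMap.le_opNorm _ z).trans ?_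
    rw [LinearIsometryEquiv.norm_map]
    exact mul_le_mul_of_nonneg_right (norm_bilinToMultilin_le B) (norm_nonneg z)

theorem tensorLift_bracket (B : V →L[ℝ] V →L[ℝ] E) (X : ℝ → V) (XX : ℝ → ℝ → ProjTensor V)
    (s t : ℝ) : tensorLift B (bracket X XX s t) =
      B (incr X s t) (incr X s t) - (2 : ℝ) • tensorLift B (XX s t) := by
  rw [bracket, map_sub, map_smul, tensorLift_elemTensor]

theorem IsRoughPath.tensorLift_chen {T α : ℝ} {X : ℝ → V} {XX : ℝ → ℝ → ProjTensor V}
    (h : IsRoughPath T α X XX) (B : V →L[ℝ] V →L[ℝ] E) {s u t : ℝ} (hs : s ∈ Set.Icc 0 T)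
    (hu : u ∈ Set.Icc 0 T) (ht : t ∈ Set.Icc 0 T) :
    tensorLift B (XX s t) =
      tensorLift B (XX s u) + tensorLift B (XX u t) + B (incr X s u) (incr X u t) := by
  rw [← tensorLift_elemTensor B, ← h.chen s hs u hu t ht, map_sub, map_sub]
  abel

end TensorLift

/-! ### Hölder bounds with explicit constants. -/

section Holder

variable {E : Type u} [NormedAddCommGroup E]

/-- `Ψ` is bounded by `C |t - s|^γ` on `[0,T]²`. -/
def HolderBound (T γ C : ℝ) (Ψ : ℝ → ℝ → E) : Prop :=
  ∀ s ∈ Set.Icc 0 T, ∀ t ∈ Set.Icc 0 T, ‖Ψ s t‖ ≤ C * |t - s| ^ γ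

/-- The seminorm ignores the diagonal; vanishing there lets the bound hold for all pairs. -/
theorem IsHolder₂.exists_bound {T γ : ℝ} {Ψ : ℝ → ℝ → E} (h : IsHolder₂ T γ Ψ)
    (h0 : ∀ s ∈ Set.Icc 0 T, Ψ s s = 0) : ∃ C, 0 ≤ C ∧ HolderBound T γ C Ψ := by
  obtain ⟨C, hC⟩ := h
  refine ⟨|C|, abs_nonneg C, fun s hs t ht => ?_⟩
  rcases eq_or_ne s t with rfl | hne
  · rw [h0 s hs, norm_zero]; positivity
  · exact (hC s hs t ht hne).trans (mul_le_mul_of_nonneg_right (le_abs_self C) (by positivity))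

theorem IsHolder.exists_bound {T γ : ℝ} {Φ : ℝ → E} (h : IsHolder T γ Φ) :
    ∃ C, 0 ≤ C ∧ HolderBound T γ C (incr Φ) :=
  IsHolder₂.exists_bound h fun s _ => sub_self (Φ s)

theorem HolderBound.isHolder₂ {T γ C : ℝ} {Ψ : ℝ → ℝ → E} (h : HolderBound T γ C Ψ) :
    IsHolder₂ T γ Ψ := ⟨C, fun s hs t ht _ => h s hs t ht⟩

theorem HolderBound.norm_le_of_subset {T γ C : ℝ} (hγ : 0 ≤ γ) (hC : 0 ≤ C) {Ψ : ℝ → ℝ → E}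
    (h : HolderBound T γ C Ψ) {s u v t : ℝ} (hs : 0 ≤ s) (hsu : s ≤ u) (huv : u ≤ v)
    (hvt : v ≤ t) (ht : t ≤ T) : ‖Ψ u v‖ ≤ C * (t - s) ^ γ := by
  refine (h u ⟨hs.trans hsu, huv.trans (hvt.trans ht)⟩ v
    ⟨hs.trans (hsu.trans huv), hvt.trans ht⟩).trans (mul_le_mul_of_nonneg_left ?_ hC)
  rw [abs_of_nonneg (sub_nonneg.2 huv)]
  exact Real.rpow_le_rpow (by linarith) (by linarith) hγ

theorem HolderBound.bounded {T γ C : ℝ} (hγ : 0 ≤ γ) (hC : 0 ≤ C) {Φ : ℝ → E}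
    (h : HolderBound T γ C (incr Φ)) :
    ∀ t ∈ Set.Icc 0 T, ‖Φ t‖ ≤ ‖Φ 0‖ + C * T ^ γ := by
  intro t ht
  have := h.norm_le_of_subset hγ hC le_rfl le_rfl ht.1 ht.2 le_rfl
  rw [sub_zero] at this
  calc ‖Φ t‖ = ‖Φ 0 + incr Φ 0 t‖ := by rw [incr]; congr 1; abel
    _ ≤ _ := norm_add_le_of_le le_rfl this

end Holder

/-! ### Almost additivity of the rough and Young summands. -/

section AlmostAdditive

variable {V : Type u} [NormedAddCommGroup V] [NormedSpace ℝ V]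
  {E : Type u} [NormedAddCommGroup E] [NormedSpace ℝ E] [CompleteSpace E]

theorem rpow_three_mul {x α : ℝ} (hx : 0 ≤ x) : x ^ (3 * α) = (x ^ α) ^ 3 := by
  rw [mul_comm, Real.rpow_mul hx]; norm_cast

theorem rpow_two_mul {x α : ℝ} (hx : 0 ≤ x) : x ^ (2 * α) = (x ^ α) ^ 2 := by
  rw [mul_comm, Real.rpow_mul hx]; norm_cast

theorem IsRoughPath.exists_bound {T α : ℝ} {X : ℝ → V} {XX : ℝ → ℝ → ProjTensor V}
    (h : IsRoughPath T α X XX) : ∃ C, 0 ≤ C ∧ HolderBound T (2 * α) C XX := by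
  refine h.holder₂.exists_bound fun s hs => ?_
  have := h.chen s hs s hs s hs
  have h0 : elemTensor (incr X s s) (incr X s s) = 0 := by
    rw [incr, sub_self, elemTensor, MultilinearMap.map_coord_zero _ 0 (by simp)]
    exact UniformSpace.Completion.coe_zero
  rw [h0, sub_self, zero_sub, neg_eq_zero] at this
  exact this

/-- By Chen's relation the defect is $-(R_{s,u}X_{u,t}+Y'_{s,u}\mathbb X_{u,t})$, with $R$ the
controlled remainder: orders $2\alpha+\alpha$ and $\alpha+2\alpha$. -/
theorem IsRoughPath.almostAdditive_linearSummand {T α a b c d : ℝ} {X : ℝ → V}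
    {XX : ℝ → ℝ → ProjTensor V} (h : IsRoughPath T α X XX) (hα : 0 ≤ α)
    (ha : 0 ≤ a) (hb : 0 ≤ b) (hc : 0 ≤ c) (hd : 0 ≤ d)
    (hX : HolderBound T α c (incr X)) (hXX : HolderBound T (2 * α) d XX)
    {Y : ℝ → V →L[ℝ] E} {Y' : ℝ → V →L[ℝ] V →L[ℝ] E}
    (hR : HolderBound T (2 * α) a (fun s t => incr Y s t - Y' s (incr X s t)))
    (hY' : HolderBound T α b (incr Y')) :
    AlmostAdditive T (3 * α) (a * c + b * d) (linearSummand X XX Y Y') := by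
  intro s u t hs hsu hut ht
  have hs' : s ∈ Set.Icc 0 T := ⟨hs, by linarith⟩
  have hu' : u ∈ Set.Icc 0 T := ⟨by linarith, by linarith⟩
  have ht' : t ∈ Set.Icc 0 T := ⟨by linarith, by linarith⟩
  have key : linearSummand X XX Y Y' s t - linearSummand X XX Y Y' s u -
      linearSummand X XX Y Y' u t =
      -((incr Y s u - Y' s (incr X s u)) (incr X u t) + tensorLift (incr Y' s u) (XX u t)) := by
    have e : incr X s t = incr X s u + incr X u t := by simp [incr]
    simp only [linearSummand, h.tensorLift_chen (Y' s) hs' hu' ht', e, map_add,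
      show incr Y s u = Y u - Y s from rfl, show incr Y' s u = Y' u - Y' s from rfl,
      sub_apply, tensorLift_sub]
    abel
  have b1 := hR.norm_le_of_subset (by positivity) ha hs le_rfl hsu hut ht
  have b2 := hX.norm_le_of_subset hα hc hs hsu hut le_rfl ht
  have b3 := hY'.norm_le_of_subset hα hb hs le_rfl hsu hut ht
  have b4 := hXX.norm_le_of_subset (by positivity) hd hs hsu hut le_rfl ht
  have hst : 0 ≤ t - s := by linarith
  rw [rpow_two_mul hst] at b1 b4
  have hp : 0 ≤ (t - s) ^ α := by positivity
  rw [key, norm_neg, rpow_three_mul hst]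
  calc _ ≤ a * ((t - s) ^ α) ^ 2 * (c * (t - s) ^ α) + b * (t - s) ^ α * (d * ((t - s) ^ α) ^ 2) :=
        norm_add_le_of_le
          ((ContinuousLinearMap.le_opNorm _ _).trans
            (mul_le_mul b1 b2 (norm_nonneg _) (by positivity)))
          ((norm_tensorLift_apply_le _ _).trans
            (mul_le_mul b3 b4 (norm_nonneg _) (by positivity)))
    _ = _ := by ring

/-- The defect of $\langle X\rangle$ is $X_{u,t}\otimes X_{s,u}-X_{s,u}\otimes X_{u,t}$, which a
symmetric $A_s$ annihilates. Only $A_{s,u}\langle X\rangle_{u,t}$ is left, of order $3\alpha$. -/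
theorem IsRoughPath.almostAdditive_youngSummand {T α b c d : ℝ} {X : ℝ → V}
    {XX : ℝ → ℝ → ProjTensor V} (h : IsRoughPath T α X XX) (hα : 0 ≤ α)
    (hb : 0 ≤ b) (hc : 0 ≤ c) (hd : 0 ≤ d)
    (hX : HolderBound T α c (incr X)) (hXX : HolderBound T (2 * α) d XX)
    {A : ℝ → V →L[ℝ] V →L[ℝ] E} (hA : HolderBound T α b (incr A))
    (hsymm : ∀ r v w, A r v w = A r w v) :
    AlmostAdditive T (3 * α) (b * (c ^ 2 + 2 * d)) (youngSummand X XX A) := by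
  intro s u t hs hsu hut ht
  have hs' : s ∈ Set.Icc 0 T := ⟨hs, by linarith⟩
  have hu' : u ∈ Set.Icc 0 T := ⟨by linarith, by linarith⟩
  have ht' : t ∈ Set.Icc 0 T := ⟨by linarith, by linarith⟩
  have key : youngSummand X XX A s t - youngSummand X XX A s u - youngSummand X XX A u t =
      -(incr A s u (incr X u t) (incr X u t) - (2 : ℝ) • tensorLift (incr A s u) (XX u t)) := by
    have e : incr X s t = incr X s u + incr X u t := by simp [incr]
    simp only [youngSummand, tensorLift_bracket, h.tensorLift_chen (A s) hs' hu' ht', e, map_add,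
      add_apply, hsymm s (incr X u t) (incr X s u)]
    simp only [show incr A s u = A u - A s from rfl, tensorLift_sub, sub_apply,
      smul_add, smul_sub, two_smul]
    abel
  have b2 := hX.norm_le_of_subset hα hc hs hsu hut le_rfl ht
  have b3 := hA.norm_le_of_subset hα hb hs le_rfl hsu hut ht
  have b4 := hXX.norm_le_of_subset (by positivity) hd hs hsu hut le_rfl ht
  have hst : 0 ≤ t - s := by linarith
  rw [rpow_two_mul hst] at b4
  have hp : 0 ≤ (t - s) ^ α := by positivity
  rw [key, norm_neg, rpow_three_mul hst]
  calc _ ≤ b * (t - s) ^ α * (c * (t - s) ^ α) * (c * (t - s) ^ α) +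
        2 * (b * (t - s) ^ α * (d * ((t - s) ^ α) ^ 2)) := by
        refine norm_sub_le_of_le ((ContinuousLinearMap.le_opNorm₂ _ _ _).trans ?_) ?_
        · exact mul_le_mul (mul_le_mul b3 b2 (norm_nonneg _) (by positivity)) b2 (norm_nonneg _)
            (by positivity)
        · rw [norm_smul, Real.norm_eq_abs, abs_two]
          exact mul_le_mul_of_nonneg_left ((norm_tensorLift_apply_le _ _).trans
            (mul_le_mul b3 b4 (norm_nonneg _) (by positivity))) zero_le_two
    _ = _ := by ring

end AlmostAdditive

/-! ### Taylor estimates with Lipschitz top derivative. -/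

section Taylor

variable {V : Type*} [NormedAddCommGroup V] [NormedSpace ℝ V]
  {E : Type*} [NormedAddCommGroup E] [NormedSpace ℝ E]

theorem norm_sub_le_of_mem_segment_left {x z w : V} (hw : w ∈ segment ℝ x z) :
    ‖w - x‖ ≤ ‖z - x‖ := by
  rw [segment_eq_image'] at hw
  obtain ⟨θ, ⟨h0, h1⟩, rfl⟩ := hw
  rw [add_sub_cancel_left, norm_smul, Real.norm_of_nonneg h0]
  exact mul_le_of_le_one_left (norm_nonneg _) h1

/-- First order Taylor estimate. -/
theorem norm_taylor_one_le {U : Set V} (hU : Convex ℝ U) {φ : V → E} {φ' : V → V →L[ℝ] E}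
    (hφ : ∀ z ∈ U, HasFDerivAt φ (φ' z) z) {x : V} (hx : x ∈ U) {L : ℝ} (hL0 : 0 ≤ L)
    (hL : ∀ z ∈ U, ‖φ' z - φ' x‖ ≤ L * ‖z - x‖) {z : V} (hz : z ∈ U) :
    ‖φ z - φ x - φ' x (z - x)‖ ≤ L * ‖z - x‖ ^ 2 := by
  have hseg := hU.segment_subset hx hz
  have := (convex_segment x z).norm_image_sub_le_of_norm_hasFDerivWithin_le' (𝕜 := ℝ)
    (f := φ) (f' := φ') (φ := φ' x) (C := L * ‖z - x‖)
    (fun w hw => (hφ w (hseg hw)).hasFDerivWithinAt)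
    (fun w hw => (hL w (hseg hw)).trans
      (mul_le_mul_of_nonneg_left (norm_sub_le_of_mem_segment_left hw) hL0))
    (left_mem_segment ℝ x z) (right_mem_segment ℝ x z)
  rwa [mul_assoc, ← sq] at this

/-- Second order Taylor estimate. -/
theorem norm_taylor_two_le {U : Set V} (hU : Convex ℝ U) {φ : V → E} {φ' : V → V →L[ℝ] E}
    {φ'' : V → V →L[ℝ] V →L[ℝ] E} (hφ : ∀ z, HasFDerivAt φ (φ' z) z)
    (hφ' : ∀ z, HasFDerivAt φ' (φ'' z) z) {x : V} (hx : x ∈ U) {L : ℝ} (hL0 : 0 ≤ L)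
    (hL : ∀ z ∈ U, ‖φ'' z - φ'' x‖ ≤ L * ‖z - x‖) {z : V} (hz : z ∈ U) :
    ‖φ z - φ x - φ' x (z - x) - (1 / 2 : ℝ) • φ'' x (z - x) (z - x)‖ ≤ L * ‖z - x‖ ^ 3 := by
  have hseg := hU.segment_subset hx hz
  have hsymm := second_derivative_symmetric hφ (hφ' x)
  set ψ : V → E := fun w => φ w - φ' x (w - x) - (1 / 2 : ℝ) • φ'' x (w - x) (w - x) with hψdef
  -- Symmetry of $\varphi''_x$ absorbs the factor ½, so the derivative of the remainder is the first
  -- order Taylor remainder of $\varphi'$, which is quadratic.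
  have hψ : ∀ w, HasFDerivAt ψ (φ' w - φ' x - φ'' x (w - x)) w := by
    intro w
    have h1 : HasFDerivAt (fun w : V => w - x) (ContinuousLinearMap.id ℝ V) w :=
      (hasFDerivAt_id w).sub_const x
    have h2 := (φ' x).hasFDerivAt.comp w h1
    have h3 := ((φ'' x).hasFDerivAt.comp w h1).clm_apply h1
    refine (((hφ w).sub h2).sub (h3.const_smul (1 / 2 : ℝ))).congr_fderiv ?_
    ext v
    simp only [sub_apply, ContinuousLinearMap.comp_apply, smul_apply, add_apply,
      ContinuousLinearMap.flip_apply, ContinuousLinearMap.id_apply, Function.comp,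
      hsymm v (w - x)]
    rw [← two_smul ℝ, smul_smul]
    norm_num
  have := (convex_segment x z).norm_image_sub_le_of_norm_hasFDerivWithin_le (𝕜 := ℝ)
    (f := ψ) (C := L * ‖z - x‖ ^ 2) (fun w _ => (hψ w).hasFDerivWithinAt)
    (fun w hw => (norm_taylor_one_le hU (fun w _ => hφ' w) hx hL0 hL (hseg hw)).trans (by
      gcongr; exact norm_sub_le_of_mem_segment_left hw))
    (left_mem_segment ℝ x z) (right_mem_segment ℝ x z)
  have e : ψ z - ψ x = φ z - φ x - φ' x (z - x) - (1 / 2 : ℝ) • φ'' x (z - x) (z - x) := by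
    simp only [hψdef, sub_self, map_zero, smul_zero, sub_zero]
    abel
  rw [e] at this
  exact this.trans (le_of_eq (by ring))

end Taylor

/-! ### Mixed partial derivatives and their interchange. -/

section PartialDerivatives

variable {V : Type u} [NormedAddCommGroup V] [NormedSpace ℝ V]
  {E : Type u} [NormedAddCommGroup E] [NormedSpace ℝ E]
  {U B : Set V} {C : ℝ} {g : V → V → E}

theorem hasFDerivAt_D₁ (h : ∀ y, Differentiable ℝ (fun x => g x y)) (x y : V) :
    HasFDerivAt (fun z => g z y) (D₁ g x y) x := (h y x).hasFDerivAt

theorem hasFDerivAt_D₂ (h : ∀ x, Differentiable ℝ (fun y => g x y)) (x y : V) :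
    HasFDerivAt (fun z => g x z) (D₂ g x y) y := (h x y).hasFDerivAt

/-- `g` is bounded by `C` on `U × B`. -/
def BoundOn (U B : Set V) (C : ℝ) (g : V → V → E) : Prop := ∀ x ∈ U, ∀ y ∈ B, ‖g x y‖ ≤ C

theorem BoundOn.lip_fst (hU : Convex ℝ U) (h : BoundOn U B C (D₁ g))
    (hg : ∀ y, Differentiable ℝ (fun x => g x y)) {x x' y : V} (hx : x ∈ U) (hx' : x' ∈ U)
    (hy : y ∈ B) : ‖g x' y - g x y‖ ≤ C * ‖x' - x‖ :=
  hU.norm_image_sub_le_of_norm_hasFDerivWithin_le (𝕜 := ℝ)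
    (fun z _ => (hasFDerivAt_D₁ hg z y).hasFDerivWithinAt) (fun z hz => h z hz y hy) hx hx'

theorem BoundOn.lip_snd (hB : Convex ℝ B) (h : BoundOn U B C (D₂ g))
    (hg : ∀ x, Differentiable ℝ (fun y => g x y)) {x y y' : V} (hx : x ∈ U) (hy : y ∈ B)
    (hy' : y' ∈ B) : ‖g x y' - g x y‖ ≤ C * ‖y' - y‖ :=
  hB.norm_image_sub_le_of_norm_hasFDerivWithin_le (𝕜 := ℝ)
    (fun z _ => (hasFDerivAt_D₂ hg x z).hasFDerivWithinAt) (fun z hz => h x hx z hz) hy hy'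

/-- A bound on `D₂ D₁ g` controls rectangular increments of `g`. -/
theorem BoundOn.norm_rect_le (hU : Convex ℝ U) (hB : Convex ℝ B) (h : BoundOn U B C (D₂ (D₁ g)))
    (hg : ∀ y, Differentiable ℝ (fun x => g x y))
    (hg' : ∀ x, Differentiable ℝ (fun y => D₁ g x y)) {x x' y y' : V} (hx : x ∈ U)
    (hx' : x' ∈ U) (hy : y ∈ B) (hy' : y' ∈ B) :
    ‖(g x' y' - g x' y) - (g x y' - g x y)‖ ≤ C * ‖y' - y‖ * ‖x' - x‖ :=
  hU.norm_image_sub_le_of_norm_hasFDerivWithin_le (𝕜 := ℝ) (f := fun z => g z y' - g z y)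
    (fun z _ => ((hasFDerivAt_D₁ hg z y').sub (hasFDerivAt_D₁ hg z y)).hasFDerivWithinAt)
    (fun _ hz => h.lip_snd hB hg' hz hy hy') hx hx'

/-- A bound on `D₂ D₁ g` makes `D₂ g` Lipschitz in the first argument. -/
theorem BoundOn.lip_D₂ (hU : Convex ℝ U) (hB : Convex ℝ B) (hBo : IsOpen B) (hC : 0 ≤ C)
    (h : BoundOn U B C (D₂ (D₁ g))) (hg : ∀ y, Differentiable ℝ (fun x => g x y))
    (hg' : ∀ x, Differentiable ℝ (fun y => D₁ g x y))
    (hg₂ : ∀ x, Differentiable ℝ (fun y => g x y)) {x x' y : V} (hx : x ∈ U)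
    (hx' : x' ∈ U) (hy : y ∈ B) : ‖D₂ g x' y - D₂ g x y‖ ≤ C * ‖x' - x‖ := by
  -- A derivative is no larger than a local Lipschitz constant at its base point, here that of
  -- $y'\mapsto g(x',y')-g(x,y')$ supplied by the rectangle bound.
  refine ((hasFDerivAt_D₂ hg₂ x' y).sub (hasFDerivAt_D₂ hg₂ x y)).le_of_lip' (by positivity) ?_
  filter_upwards [hBo.mem_nhds hy] with y' hy'
  have := h.norm_rect_le hU hB hg hg' hx hx' hy hy'
  calc _ = ‖(g x' y' - g x' y) - (g x y' - g x y)‖ := by simp only [Pi.sub_apply]; congr 1; abel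
    _ ≤ _ := this.trans (le_of_eq (by ring))

/-- The first order expansion of `D₂ g` in the first argument, with the derivatives of `g`
interchanged. -/
theorem BoundOn.norm_D₂_taylor_le (hU : Convex ℝ U) (hB : Convex ℝ B) (hBo : IsOpen B)
    (hC : 0 ≤ C) (h : BoundOn U B C (D₂ (D₁ (D₁ g))))
    (hg : ∀ y, Differentiable ℝ (fun x => g x y))
    (hgg : ∀ y, Differentiable ℝ (fun x => D₁ g x y))
    (hg₂ : ∀ x, Differentiable ℝ (fun y => g x y))
    (hg' : ∀ x, Differentiable ℝ (fun y => D₁ g x y))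
    (hgg' : ∀ x, Differentiable ℝ (fun y => D₁ (D₁ g) x y)) {x x' y : V} (hx : x ∈ U)
    (hx' : x' ∈ U) (hy : y ∈ B) :
    ‖D₂ g x' y - D₂ g x y - (D₂ (D₁ g) x y).flip (x' - x)‖ ≤ C * ‖x' - x‖ ^ 2 := by
  -- The quantity to bound is the derivative at $y$ of $y'\mapsto
  -- g(x',y')-g(x,y')-D_1g(x,y')(x'-x)$. The increments of this map are Taylor remainders in $x$, of
  -- size $C\|y'-y\|\,\|x'-x\|^2$.
  have hd := ((hasFDerivAt_D₂ hg₂ x' y).sub (hasFDerivAt_D₂ hg₂ x y)).sub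
    ((hasFDerivAt_D₂ hg' x y).clm_apply (hasFDerivAt_const (x' - x) y))
  simp only [ContinuousLinearMap.comp_zero, zero_add] at hd
  refine hd.le_of_lip' (by positivity) ?_
  filter_upwards [hBo.mem_nhds hy] with y' hy'
  have := norm_taylor_one_le hU (φ := fun z => g z y' - g z y)
    (fun z _ => (hasFDerivAt_D₁ hg z y').sub (hasFDerivAt_D₁ hg z y)) hx
    (L := C * ‖y' - y‖) (by positivity)
    (fun z hz => h.norm_rect_le hU hB hgg hgg' hx hz hy hy') hx'
  calc _ = ‖(g x' y' - g x' y) - (g x y' - g x y) - (D₁ g x y' - D₁ g x y) (x' - x)‖ := by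
        simp only [Pi.sub_apply, sub_apply]; congr 1; abel
    _ ≤ _ := this.trans (le_of_eq (by ring))

theorem hasFDerivAt_of_norm_le_sq {φ : V → E} {L : V →L[ℝ] E} {x : V} (hUo : U ∈ nhds x)
    (h : ∀ x' ∈ U, ‖φ x' - φ x - L (x' - x)‖ ≤ C * ‖x' - x‖ ^ 2) : HasFDerivAt φ L x := by
  refine .of_isLittleO (Asymptotics.IsBigO.trans_isLittleO ?_
    (Asymptotics.isLittleO_pow_sub_sub x one_lt_two))
  refine Asymptotics.IsBigO.of_bound C ?_
  filter_upwards [hUo] with x' hx'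
  rw [Real.norm_of_nonneg (by positivity)]
  exact h x' hx'

end PartialDerivatives

/-! ### From growth on compact sets to bounds on neighbourhoods. -/

section LocalBounds

variable {V : Type u} [NormedAddCommGroup V] {E : Type u} [NormedAddCommGroup E]
  {g : V → V → E} {b : ℝ}

/-- Otherwise $g$ is unbounded along some sequence converging to $x$; the sequence together with its
limit is compact, which contradicts the growth bound there. -/
theorem GrowthBound.eventually_nhds (h : GrowthBound b g) (hb : 0 ≤ b) (R : ℝ) (x : V) :
    ∃ C, ∀ᶠ z in nhds x, ∀ y ∈ Metric.ball (0 : V) R, ‖g z y‖ ≤ C := by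
  by_contra! hcon
  have hseq : ∀ n : ℕ, ∃ z, z ∈ Metric.ball x (1 / (n + 1)) ∧
      ∃ y ∈ Metric.ball (0 : V) R, (n : ℝ) < ‖g z y‖ := fun n => by
    have := (hcon n).and_eventually (Metric.ball_mem_nhds x (Nat.one_div_pos_of_nat (n := n)))
    obtain ⟨z, hz, hzb⟩ := this.exists
    exact ⟨z, hzb, by simpa using hz⟩
  choose z hz y hy hzy using hseq
  have hlim : Filter.Tendsto z Filter.atTop (nhds x) := by
    rw [tendsto_iff_dist_tendsto_zero]
    exact squeeze_zero (fun _ => dist_nonneg) (fun n => (Metric.mem_ball.1 (hz n)).le)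
      tendsto_one_div_add_atTop_nhds_zero_nat
  obtain ⟨C, hC⟩ := h _ hlim.isCompact_insert_range
  obtain ⟨n, hn⟩ := exists_nat_gt (|C| * (1 + R) ^ b)
  have hyn := mem_ball_zero_iff.1 (hy n)
  have h1 := hC (z n) (Set.mem_insert_of_mem _ ⟨n, rfl⟩) (y n)
  have h2 : (1 + ‖y n‖) ^ b ≤ (1 + R) ^ b :=
    Real.rpow_le_rpow (by positivity) (by linarith) hb
  have h3 : C * (1 + ‖y n‖) ^ b ≤ |C| * (1 + R) ^ b :=
    mul_le_mul (le_abs_self C) h2 (by positivity) (abs_nonneg C)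
  linarith [hzy n]

/-- Asking for all large $C$ instead of one lets finite unions, and later several derivatives, share
a constant. -/
theorem GrowthBound.eventually_nhdsSet (h : GrowthBound b g) (hb : 0 ≤ b) (R : ℝ) {K : Set V}
    (hK : IsCompact K) :
    ∀ᶠ C in Filter.atTop, ∀ᶠ z in nhdsSet K, ∀ y ∈ Metric.ball (0 : V) R, ‖g z y‖ ≤ C := by
  refine hK.induction_on (p := fun K => ∀ᶠ C in Filter.atTop, ∀ᶠ z in nhdsSet K,
    ∀ y ∈ Metric.ball (0 : V) R, ‖g z y‖ ≤ C) (by simp)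
    (fun s t hst ht => ht.mono fun C hC => hC.filter_mono (nhdsSet_mono hst))
    (fun s t hs ht => ?_) fun x _ => ?_
  · filter_upwards [hs, ht] with C h1 h2
    rw [nhdsSet_union]
    exact Filter.eventually_sup.2 ⟨h1, h2⟩
  · obtain ⟨C, hC⟩ := h.eventually_nhds hb R x
    obtain ⟨O, hO, hOo, hxO⟩ := eventually_nhds_iff.1 hC
    refine ⟨O, mem_nhdsWithin_of_mem_nhds (hOo.mem_nhds hxO), ?_⟩
    filter_upwards [Filter.eventually_ge_atTop C] with C' hC'
    exact Filter.mem_of_superset hOo.mem_nhdsSet_self fun z hz y hy => (hO z hz y hy).trans hC'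

end LocalBounds

/-! ### Regularity of $f$ and of $h^{x,y}$. -/

section Regularity

variable {V : Type u} [NormedAddCommGroup V] [NormedSpace ℝ V]

/-- The differentiability properties of `f ∈ 𝒞_loc^{3,β₂}`. -/
structure PartialDifferentiable (f : V → V → V) : Prop where
  fst₀ : ∀ y, Differentiable ℝ (fun x => f x y)
  fst₁ : ∀ y, Differentiable ℝ (fun x => D₁ f x y)
  fst₂ : ∀ y, Differentiable ℝ (fun x => D₁ (D₁ f) x y)
  snd₀ : ∀ x, Differentiable ℝ (fun y => f x y)
  snd₁ : ∀ x, Differentiable ℝ (fun y => D₁ f x y)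
  snd₂ : ∀ x, Differentiable ℝ (fun y => D₁ (D₁ f) x y)
  snd₃ : ∀ x, Differentiable ℝ (fun y => D₁ (D₁ (D₁ f)) x y)
  snd₁₂ : ∀ x, Differentiable ℝ (fun y => D₂ (D₁ f) x y)

/-- The partial derivatives of `f` are bounded by `C` on `U × B`. -/
structure DerivBounds (U B : Set V) (C : ℝ) (f : V → V → V) : Prop where
  d₀ : BoundOn U B C f
  d₁ : BoundOn U B C (D₁ f)
  d₁₁ : BoundOn U B C (D₁ (D₁ f))
  d₁₁₁ : BoundOn U B C (D₁ (D₁ (D₁ f)))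
  d₂₁ : BoundOn U B C (D₂ (D₁ f))
  d₂₁₁ : BoundOn U B C (D₂ (D₁ (D₁ f)))
  d₂₁₁₁ : BoundOn U B C (D₂ (D₁ (D₁ (D₁ f))))
  d₂₂₁ : BoundOn U B C (D₂ (D₂ (D₁ f)))

variable {f : V → V → V}

theorem MemCloc.partialDifferentiable {β : Fin 3 → ℝ} (hf : MemCloc 3 2 β f) :
    PartialDifferentiable f := by
  obtain ⟨⟨-, a0, -⟩, e0, ⟨-, a1, -, b1, -⟩, e1, ⟨-, a2, -⟩, e2, -, a3, -⟩ := hf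
  exact ⟨e0, e1, e2, a0, a1, a2, a3, b1⟩

theorem MemCloc.exists_derivBounds {β : Fin 3 → ℝ} (hβ : ∀ k, 0 ≤ β k) (hf : MemCloc 3 2 β f)
    {K : Set V} (hK : IsCompact K) (R : ℝ) :
    ∃ r > 0, ∃ C, 0 ≤ C ∧ DerivBounds (Metric.thickening r K) (Metric.ball 0 R) C f := by
  obtain ⟨⟨a0, -⟩, -, ⟨a1, -, b1, -, c1⟩, -, ⟨a2, -, b2, -⟩, -, a3, -, b3, -⟩ := hf
  obtain ⟨C, hC, h0, h1, h2, h3, h4, h5, h6, h7⟩ := ((Filter.eventually_ge_atTop (0 : ℝ)).and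
    ((a0.eventually_nhdsSet (hβ _) R hK).and ((a1.eventually_nhdsSet (hβ _) R hK).and
    ((a2.eventually_nhdsSet (hβ _) R hK).and ((a3.eventually_nhdsSet (hβ _) R hK).and
    ((b1.eventually_nhdsSet (hβ _) R hK).and ((b2.eventually_nhdsSet (hβ _) R hK).and
    ((b3.eventually_nhdsSet (hβ _) R hK).and
    (c1.eventually_nhdsSet (hβ _) R hK))))))))).exists
  have hall := h0.and (h1.and (h2.and (h3.and (h4.and (h5.and (h6.and h7))))))
  obtain ⟨O, hOo, hKO, hO⟩ := mem_nhdsSet_iff_exists.1 hall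
  obtain ⟨r, hr, hrO⟩ := hK.exists_thickening_subset_open hOo hKO
  exact ⟨r, hr, C, hC, fun x hx => (hO (hrO hx)).1, fun x hx => (hO (hrO hx)).2.1,
    fun x hx => (hO (hrO hx)).2.2.1, fun x hx => (hO (hrO hx)).2.2.2.1,
    fun x hx => (hO (hrO hx)).2.2.2.2.1, fun x hx => (hO (hrO hx)).2.2.2.2.2.1,
    fun x hx => (hO (hrO hx)).2.2.2.2.2.2.1, fun x hx => (hO (hrO hx)).2.2.2.2.2.2.2⟩

/-- $D_1D_2f$ is not among the given derivatives; local boundedness of $D_{211}f$ yields it as the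
flip of $D_{21}f$. -/
theorem MemCloc.hasFDerivAt_D₂ {β : Fin 3 → ℝ} (hβ : ∀ k, 0 ≤ β k) (hf : MemCloc 3 2 β f)
    (z y : V) : HasFDerivAt (fun z => D₂ f z y) (D₂ (D₁ f) z y).flip z := by
  obtain ⟨r, hr, C, hC, hb⟩ := hf.exists_derivBounds hβ (isCompact_singleton (x := z)) (‖y‖ + 1)
  have hd := hf.partialDifferentiable
  rw [Metric.thickening_singleton] at hb
  exact hasFDerivAt_of_norm_le_sq (Metric.ball_mem_nhds z hr) fun x' hx' =>
    hb.d₂₁₁.norm_D₂_taylor_le (convex_ball _ _) (convex_ball _ _) Metric.isOpen_ball hC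
      hd.fst₀ hd.fst₁ hd.snd₀ hd.snd₁ hd.snd₂ (Metric.mem_ball_self hr) hx' (by simp)

theorem MemCloc.hasFDerivAt_D₂₁ {β : Fin 3 → ℝ} (hβ : ∀ k, 0 ≤ β k) (hf : MemCloc 3 2 β f)
    (z y : V) : HasFDerivAt (fun z => D₂ (D₁ f) z y) (D₂ (D₁ (D₁ f)) z y).flip z := by
  obtain ⟨r, hr, C, hC, hb⟩ := hf.exists_derivBounds hβ (isCompact_singleton (x := z)) (‖y‖ + 1)
  have hd := hf.partialDifferentiable
  rw [Metric.thickening_singleton] at hb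
  exact hasFDerivAt_of_norm_le_sq (Metric.ball_mem_nhds z hr) fun x' hx' =>
    hb.d₂₁₁₁.norm_D₂_taylor_le (convex_ball _ _) (convex_ball _ _) Metric.isOpen_ball hC
      hd.fst₁ hd.fst₂ hd.snd₁ hd.snd₂ hd.snd₃ (Metric.mem_ball_self hr) hx' (by simp)

theorem PartialDifferentiable.D₁₁_symm (hd : PartialDifferentiable f) (x y v w : V) :
    D₁ (D₁ f) x y v w = D₁ (D₁ f) x y w v :=
  second_derivative_symmetric (fun z => hasFDerivAt_D₁ hd.fst₀ z y) (hasFDerivAt_D₁ hd.fst₁ x y)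
    v w

/-- Differentiate the symmetry of $D_{11}f(x,\cdot)$ in the second argument. -/
theorem PartialDifferentiable.D₂₁₁_symm (hd : PartialDifferentiable f) (x y a v w : V) :
    D₂ (D₁ (D₁ f)) x y a v w = D₂ (D₁ (D₁ f)) x y a w v := by
  have h := hasFDerivAt_D₂ hd.snd₂ x y
  have h1 := (h.clm_apply (hasFDerivAt_const v y)).clm_apply (hasFDerivAt_const w y)
  have h2 := (h.clm_apply (hasFDerivAt_const w y)).clm_apply (hasFDerivAt_const v y)
  simp only [hd.D₁₁_symm x _ v w] at h1
  have := congrArg (fun L => L a) (h1.unique h2)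
  simpa using this

/-- The derivative of `h^{x,y}`. -/
noncomputable def compHDeriv (f : V → V → V) (x y z : V) : V →L[ℝ] V →L[ℝ] V :=
  D₂ (D₁ (D₁ f)) z y (f z x) + (D₂ (D₁ f) z y).comp (D₁ f z x)

theorem MemCloc.hasFDerivAt_compH {β : Fin 3 → ℝ} (hβ : ∀ k, 0 ≤ β k) (hf : MemCloc 3 2 β f)
    (x y z : V) : HasFDerivAt (compH f x y) (compHDeriv f x y z) z := by
  have h := (hf.hasFDerivAt_D₂₁ hβ z y).clm_apply
    (hasFDerivAt_D₁ hf.partialDifferentiable.fst₀ z x)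
  rw [ContinuousLinearMap.flip_flip, add_comm] at h
  exact h

theorem norm_clm_apply_sub_le {F G : Type*} [NormedAddCommGroup F] [NormedSpace ℝ F]
    [NormedAddCommGroup G] [NormedSpace ℝ G] {A A' : F →L[ℝ] G} {v v' : F} {C d : ℝ}
    (hC : 0 ≤ C) (hd : 0 ≤ d)
    (hA : ‖A‖ ≤ C) (hv : ‖v'‖ ≤ C) (hAA : ‖A' - A‖ ≤ C * d) (hvv : ‖v' - v‖ ≤ C * d) :
    ‖A' v' - A v‖ ≤ 2 * C ^ 2 * d := by
  have e : A' v' - A v = (A' - A) v' + A (v' - v) := by simp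
  rw [e]
  calc _ ≤ C * d * C + C * (C * d) := norm_add_le_of_le
        ((ContinuousLinearMap.le_opNorm _ _).trans
          (mul_le_mul hAA hv (norm_nonneg _) (by positivity)))
        ((ContinuousLinearMap.le_opNorm _ _).trans
          (mul_le_mul hA hvv (norm_nonneg _) (by positivity)))
    _ = _ := by ring

theorem norm_clm_comp_sub_le {F G H : Type*} [NormedAddCommGroup F] [NormedSpace ℝ F]
    [NormedAddCommGroup G] [NormedSpace ℝ G] [NormedAddCommGroup H] [NormedSpace ℝ H]
    {A A' : F →L[ℝ] G} {v v' : H →L[ℝ] F} {C d : ℝ} (hC : 0 ≤ C) (hd : 0 ≤ d)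
    (hA : ‖A‖ ≤ C) (hv : ‖v'‖ ≤ C) (hAA : ‖A' - A‖ ≤ C * d) (hvv : ‖v' - v‖ ≤ C * d) :
    ‖A'.comp v' - A.comp v‖ ≤ 2 * C ^ 2 * d := by
  have e : A'.comp v' - A.comp v = (A' - A).comp v' + A.comp (v' - v) := by
    simp [ContinuousLinearMap.sub_comp, ContinuousLinearMap.comp_sub]
  rw [e]
  calc _ ≤ C * d * C + C * (C * d) := norm_add_le_of_le
        ((ContinuousLinearMap.opNorm_comp_le _ _).trans
          (mul_le_mul hAA hv (norm_nonneg _) (by positivity)))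
        ((ContinuousLinearMap.opNorm_comp_le _ _).trans
          (mul_le_mul hA hvv (norm_nonneg _) (by positivity)))
    _ = _ := by ring

/-- The partial derivatives of `f` exist, and are bounded by `C` on the product of the convex
sets `U` and `B`. -/
structure LocallyRegular (U B : Set V) (C : ℝ) (f : V → V → V) : Prop
    extends DerivBounds U B C f, PartialDifferentiable f where
  convex_fst : Convex ℝ U
  convex_snd : Convex ℝ B
  isOpen_snd : IsOpen B
  nonneg : 0 ≤ C

variable {U B : Set V} {C : ℝ}

theorem LocallyRegular.lip_D₂₁ (h : LocallyRegular U B C f)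
    {z z' y : V} (hz : z ∈ U) (hz' : z' ∈ U) (hy : y ∈ B) :
    ‖D₂ (D₁ f) z' y - D₂ (D₁ f) z y‖ ≤ C * ‖z' - z‖ :=
  h.d₂₁₁.lip_D₂ h.convex_fst h.convex_snd h.isOpen_snd h.nonneg h.fst₁ h.snd₂ h.snd₁ hz hz' hy

theorem LocallyRegular.lip_compA (h : LocallyRegular U B C f)
    {x y z z' : V} (hx : x ∈ B) (hy : y ∈ B) (hz : z ∈ U)
    (hz' : z' ∈ U) :
    ‖D₂ (D₁ (D₁ f)) z' y (f z' x) - D₂ (D₁ (D₁ f)) z y (f z x)‖ ≤ 2 * C ^ 2 * ‖z' - z‖ :=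
  norm_clm_apply_sub_le h.nonneg (norm_nonneg _) (h.d₂₁₁ z hz y hy) (h.d₀ z' hz' x hx)
    (h.d₂₁₁₁.lip_D₂ h.convex_fst h.convex_snd h.isOpen_snd h.nonneg
      h.fst₂ h.snd₃ h.snd₂ hz hz' hy)
    (h.d₁.lip_fst h.convex_fst h.fst₀ hz hz' hx)

theorem LocallyRegular.lip_compH (h : LocallyRegular U B C f)
    {x y z z' : V} (hx : x ∈ B) (hy : y ∈ B) (hz : z ∈ U)
    (hz' : z' ∈ U) : ‖compH f x y z' - compH f x y z‖ ≤ 2 * C ^ 2 * ‖z' - z‖ :=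
  norm_clm_apply_sub_le h.nonneg (norm_nonneg _) (h.d₂₁ z hz y hy) (h.d₀ z' hz' x hx)
    (h.lip_D₂₁ hz hz' hy) (h.d₁.lip_fst h.convex_fst h.fst₀ hz hz' hx)

theorem LocallyRegular.lip_compHDeriv (h : LocallyRegular U B C f)
    {x y z z' : V} (hx : x ∈ B) (hy : y ∈ B) (hz : z ∈ U)
    (hz' : z' ∈ U) : ‖compHDeriv f x y z' - compHDeriv f x y z‖ ≤ 4 * C ^ 2 * ‖z' - z‖ := by
  rw [compHDeriv, compHDeriv, add_sub_add_comm]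
  refine (norm_add_le_of_le (h.lip_compA hx hy hz hz')
    (norm_clm_comp_sub_le h.nonneg (norm_nonneg (z' - z)) (h.d₂₁ z hz y hy) (h.d₁ z' hz' x hx)
      (h.lip_D₂₁ hz hz' hy) (h.d₁₁.lip_fst h.convex_fst h.fst₁ hz hz' hx))).trans ?_
  exact le_of_eq (by ring)

end Regularity

/-! ### Hölder paths with values in a convex set. -/

section Paths

variable {V : Type u} [NormedAddCommGroup V] {E : Type u} [NormedAddCommGroup E]

theorem HolderBound.continuousOn {T α C : ℝ} (hα : 0 < α) {Φ : ℝ → E}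
    (h : HolderBound T α C (incr Φ)) : ContinuousOn Φ (Set.Icc 0 T) := by
  intro s hs
  rw [ContinuousWithinAt, tendsto_iff_norm_sub_tendsto_zero]
  have hc : Filter.Tendsto (fun t : ℝ => C * |t - s| ^ α) (nhds s) (nhds 0) := by
    have : Continuous fun t : ℝ => C * |t - s| ^ α :=
      continuous_const.mul ((by fun_prop : Continuous fun t : ℝ => |t - s|).rpow_const
        fun _ => Or.inr hα.le)
    simpa [Real.zero_rpow hα.ne'] using this.tendsto s
  refine squeeze_zero' (Filter.Eventually.of_forall fun _ => norm_nonneg _) ?_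
    (hc.mono_left nhdsWithin_le_nhds)
  filter_upwards [self_mem_nhdsWithin] with t ht
  exact h s hs t ht

/-- The convex hull of a compact set is totally bounded, so its closure is compact in a complete
space. -/
theorem exists_isCompact_convex_superset [NormedSpace ℝ V] [CompleteSpace V] {S : Set V}
    (hS : IsCompact S) :
    ∃ K, IsCompact K ∧ Convex ℝ K ∧ S ⊆ K :=
  ⟨closure (convexHull ℝ S), isCompact_iff_totallyBounded_isComplete.2
    ⟨hS.totallyBounded.convexHull.closure, isClosed_closure.isComplete⟩,
    (convex_convexHull ℝ S).closure,
    (subset_convexHull ℝ S).trans subset_closure⟩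

/-- The path `X` is `α`-Hölder with constant `c`, and takes its values in `U`. -/
structure HolderPathIn (T α c : ℝ) (U : Set V) (X : ℝ → V) : Prop where
  bound : HolderBound T α c (incr X)
  mem : ∀ r ∈ Set.Icc 0 T, X r ∈ U
  nonneg : 0 ≤ c

theorem HolderPathIn.comp_lip {T α c L : ℝ} {U : Set V} {X : ℝ → V} (hX : HolderPathIn T α c U X)
    (hL : 0 ≤ L) {φ : V → E} (hφ : ∀ z ∈ U, ∀ z' ∈ U, ‖φ z' - φ z‖ ≤ L * ‖z' - z‖) :
    HolderBound T α (L * c) (incr fun r => φ (X r)) := fun s hs t ht => by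
  refine (hφ _ (hX.mem s hs) _ (hX.mem t ht)).trans ?_
  rw [mul_assoc]
  exact mul_le_mul_of_nonneg_left (hX.bound s hs t ht) hL

theorem HolderPathIn.comp_lip₂ {T α c d C : ℝ} {U B : Set V} {X Y : ℝ → V}
    (hX : HolderPathIn T α c U X) (hY : HolderPathIn T α d B Y) (hC : 0 ≤ C) {g : V → V → E}
    (h₁ : ∀ x ∈ U, ∀ x' ∈ U, ∀ y ∈ B, ‖g x' y - g x y‖ ≤ C * ‖x' - x‖)
    (h₂ : ∀ x ∈ U, ∀ y ∈ B, ∀ y' ∈ B, ‖g x y' - g x y‖ ≤ C * ‖y' - y‖) :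
    HolderBound T α (C * (c + d)) (incr fun r => g (X r) (Y r)) := fun s hs t ht => by
  have e : incr (fun r => g (X r) (Y r)) s t =
      (g (X t) (Y t) - g (X s) (Y t)) + (g (X s) (Y t) - g (X s) (Y s)) := by
    rw [incr]; abel
  rw [e]
  calc _ ≤ C * (c * |t - s| ^ α) + C * (d * |t - s| ^ α) := norm_add_le_of_le
        ((h₁ _ (hX.mem s hs) _ (hX.mem t ht) _ (hY.mem t ht)).trans
          (mul_le_mul_of_nonneg_left (hX.bound s hs t ht) hC))
        ((h₂ _ (hX.mem s hs) _ (hY.mem s hs) _ (hY.mem t ht)).trans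
          (mul_le_mul_of_nonneg_left (hY.bound s hs t ht) hC))
    _ = _ := by ring

theorem HolderPathIn.sq_le {T α c : ℝ} {U : Set V} {X : ℝ → V} (hX : HolderPathIn T α c U X)
    {s t : ℝ} (hs : s ∈ Set.Icc 0 T) (ht : t ∈ Set.Icc 0 T) :
    ‖X t - X s‖ ^ 2 ≤ c ^ 2 * |t - s| ^ (2 * α) := by
  rw [rpow_two_mul (abs_nonneg _), ← mul_pow]
  exact pow_le_pow_left₀ (norm_nonneg _) (hX.bound s hs t ht) 2

theorem HolderPathIn.cube_le {T α c : ℝ} {U : Set V} {X : ℝ → V} (hX : HolderPathIn T α c U X)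
    {s t : ℝ} (hs : s ∈ Set.Icc 0 T) (ht : t ∈ Set.Icc 0 T) :
    ‖X t - X s‖ ^ 3 ≤ c ^ 3 * |t - s| ^ (3 * α) := by
  rw [rpow_three_mul (abs_nonneg _), ← mul_pow]
  exact pow_le_pow_left₀ (norm_nonneg _) (hX.bound s hs t ht) 3

end Paths

/-! ### Controlled structure of the compositions. -/

section Composition

variable {V : Type u} [NormedAddCommGroup V] [NormedSpace ℝ V]
  {T α C c d e : ℝ} {U B : Set V} {f : V → V → V} {X Y Ydot : ℝ → V}

theorem LocallyRegular.holder_compHDeriv (h : LocallyRegular U B C f)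
    (hX : HolderPathIn T α c U X) {x y : V} (hx : x ∈ B) (hy : y ∈ B) :
    HolderBound T α (4 * C ^ 2 * c) (incr fun r => compHDeriv f x y (X r)) :=
  hX.comp_lip (by positivity) fun _ hz _ hz' => h.lip_compHDeriv hx hy hz hz'

theorem LocallyRegular.remainder_compH (h : LocallyRegular U B C f)
    (hX : HolderPathIn T α c U X) {x y : V} (hx : x ∈ B) (hy : y ∈ B)
    (hD : ∀ z, HasFDerivAt (compH f x y) (compHDeriv f x y z) z) :
    HolderBound T (2 * α) (4 * C ^ 2 * c ^ 2) (fun s t => incr (fun r => compH f x y (X r)) s t -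
      compHDeriv f x y (X s) (incr X s t)) := fun s hs t ht => by
  refine (norm_taylor_one_le h.convex_fst (fun z _ => hD z) (hX.mem s hs)
    (L := 4 * C ^ 2) (by positivity)
    (fun z hz => h.lip_compHDeriv hx hy (hX.mem s hs) hz) (hX.mem t ht)).trans ?_
  rw [mul_assoc (4 * C ^ 2)]
  exact mul_le_mul_of_nonneg_left (hX.sq_le hs ht) (by positivity)

theorem LocallyRegular.isControlled_compH (h : LocallyRegular U B C f)
    (hX : HolderPathIn T α c U X) {x y : V} (hx : x ∈ B) (hy : y ∈ B)
    (hD : ∀ z, HasFDerivAt (compH f x y) (compHDeriv f x y z) z) :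
    IsControlled T α X (fun r => compH f x y (X r)) (fun r => compHDeriv f x y (X r)) where
  holder := (hX.comp_lip (L := 2 * C ^ 2) (by positivity)
    fun _ hz _ hz' => h.lip_compH hx hy hz hz').isHolder₂
  holder_deriv := (h.holder_compHDeriv hX hx hy).isHolder₂
  remainder := (h.remainder_compH hX hx hy hD).isHolder₂

theorem LocallyRegular.holder_compA (h : LocallyRegular U B C f)
    (hX : HolderPathIn T α c U X) {x y : V} (hx : x ∈ B) (hy : y ∈ B) :
    HolderBound T α (2 * C ^ 2 * c) (incr (compA f X x y)) :=
  hX.comp_lip (φ := fun z => D₂ (D₁ (D₁ f)) z y (f z x)) (by positivity)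
    fun _ hz _ hz' => h.lip_compA hx hy hz hz'

theorem LocallyRegular.holder_D₁ (h : LocallyRegular U B C f)
    (hX : HolderPathIn T α c U X) (hY : HolderPathIn T α d B Y) :
    HolderBound T α (C * (c + d)) (incr fun r => D₁ f (X r) (Y r)) :=
  hX.comp_lip₂ hY h.nonneg
    (fun _ hx _ hx' _ hy => h.d₁₁.lip_fst h.convex_fst h.fst₁ hx hx' hy)
    (fun _ hx _ hy _ hy' => h.d₂₁.lip_snd h.convex_snd h.snd₁ hx hy hy')

theorem LocallyRegular.holder_D₁₁ (h : LocallyRegular U B C f)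
    (hX : HolderPathIn T α c U X) (hY : HolderPathIn T α d B Y) :
    HolderBound T α (C * (c + d)) (incr fun r => D₁ (D₁ f) (X r) (Y r)) :=
  hX.comp_lip₂ hY h.nonneg
    (fun _ hx _ hx' _ hy => h.d₁₁₁.lip_fst h.convex_fst h.fst₂ hx hx' hy)
    (fun _ hx _ hy _ hy' => h.d₂₁₁.lip_snd h.convex_snd h.snd₂ hx hy hy')

theorem LocallyRegular.holder_D₂₁ (h : LocallyRegular U B C f)
    (hX : HolderPathIn T α c U X) (hY : HolderPathIn T α d B Y) :
    HolderBound T α (C * (c + d)) (incr fun r => D₂ (D₁ f) (X r) (Y r)) :=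
  hX.comp_lip₂ hY h.nonneg
    (fun _ hx _ hx' _ hy => h.lip_D₂₁ hx hx' hy)
    (fun _ hx _ hy _ hy' => h.d₂₂₁.lip_snd h.convex_snd h.snd₁₂ hx hy hy')

/-- Linearising $f(\cdot,\dot Y_s)$ at $X_s$ turns nonlinear control by $W$ into linear control by
$X$, at a cost of order $2\alpha$. -/
theorem LocallyRegular.remainder_solution (h : LocallyRegular U B C f)
    (hX : HolderPathIn T α c U X) (hYd : HolderPathIn T α d B Ydot)
    (hN : HolderBound T (2 * α) e
      (fun s t => incr Y s t - (compW f X t (Ydot s) - compW f X s (Ydot s)))) :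
    HolderBound T (2 * α) (e + C * c ^ 2)
      (fun s t => incr Y s t - D₁ f (X s) (Ydot s) (incr X s t)) := fun s hs t ht => by
  have b := norm_taylor_one_le h.convex_fst
    (fun z _ => hasFDerivAt_D₁ h.fst₀ z (Ydot s)) (hX.mem s hs) h.nonneg
    (fun z hz => h.d₁₁.lip_fst h.convex_fst h.fst₁ (hX.mem s hs) hz (hYd.mem s hs)) (hX.mem t ht)
  have e1 : incr Y s t - D₁ f (X s) (Ydot s) (incr X s t) =
      (incr Y s t - (compW f X t (Ydot s) - compW f X s (Ydot s))) +
      (f (X t) (Ydot s) - f (X s) (Ydot s) - D₁ f (X s) (Ydot s) (X t - X s)) := by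
    simp only [compW, incr]; abel
  beta_reduce
  rw [e1]
  refine (norm_add_le_of_le (hN s hs t ht)
    (b.trans (mul_le_mul_of_nonneg_left (hX.sq_le hs ht) h.nonneg))).trans (le_of_eq (by ring))

/-- The Gubinelli derivative of `D₁f(X,Y)`. -/
noncomputable def compDeriv (f : V → V → V) (X Y Ydot : ℝ → V) (r : ℝ) : V →L[ℝ] V →L[ℝ] V :=
  D₁ (D₁ f) (X r) (Y r) + (D₂ (D₁ f) (X r) (Y r)).comp (D₁ f (X r) (Ydot r))

theorem LocallyRegular.holder_compDeriv (h : LocallyRegular U B C f)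
    (hX : HolderPathIn T α c U X) (hY : HolderPathIn T α d B Y) (hYd : HolderPathIn T α e B Ydot) :
    HolderBound T α ((C + 2 * C ^ 2) * (c + d + e)) (incr (compDeriv f X Y Ydot)) :=
  fun s hs t ht => by
  have hC := h.nonneg
  have hc := hX.nonneg
  have hd := hY.nonneg
  have he := hYd.nonneg
  have hp : 0 ≤ |t - s| ^ α := by positivity
  have b1 := h.holder_D₁₁ hX hY s hs t ht
  have b2 := h.holder_D₂₁ hX hY s hs t ht
  have b3 := h.holder_D₁ hX hYd s hs t ht
  -- The product estimate takes one modulus for both factors, hence the common constant $c+d+e$.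
  have m : ∀ q, q ≤ c + d + e → C * q * |t - s| ^ α ≤ C * ((c + d + e) * |t - s| ^ α) :=
    fun q hq => by rw [mul_assoc]; gcongr
  have b4 := norm_clm_comp_sub_le hC (d := (c + d + e) * |t - s| ^ α) (by positivity)
    (h.d₂₁ _ (hX.mem s hs) _ (hY.mem s hs)) (h.d₁ _ (hX.mem t ht) _ (hYd.mem t ht))
    (b2.trans (m _ (by linarith))) (b3.trans (m _ (by linarith)))
  rw [incr, compDeriv, compDeriv, add_sub_add_comm]
  refine (norm_add_le_of_le (b1.trans (m _ (by linarith))) b4).trans (le_of_eq (by ring))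

theorem LocallyRegular.remainder_D₁ (h : LocallyRegular U B C f)
    (hX : HolderPathIn T α c U X) (hY : HolderPathIn T α d B Y)
    (hR : HolderBound T (2 * α) e
      (fun s t => incr Y s t - D₁ f (X s) (Ydot s) (incr X s t))) :
    HolderBound T (2 * α) (C * (c ^ 2 + c * d + d ^ 2 + e))
      (fun s t => incr (fun r => D₁ f (X r) (Y r)) s t -
        compDeriv f X Y Ydot s (incr X s t)) := fun s hs t ht => by
  have hC := h.nonneg
  have hd := hY.nonneg
  have hp : 0 ≤ |t - s| ^ α := by positivity
  have xs := hX.mem s hs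
  have xt := hX.mem t ht
  have ys := hY.mem s hs
  have yt := hY.mem t ht
  have b1 := (norm_taylor_one_le h.convex_fst (fun z _ => hasFDerivAt_D₁ h.fst₁ z (Y t)) xs hC
    (fun z hz => h.d₁₁₁.lip_fst h.convex_fst h.fst₂ xs hz yt) xt).trans
    (mul_le_mul_of_nonneg_left (hX.sq_le hs ht) hC)
  have b2 : ‖(D₁ (D₁ f) (X s) (Y t) - D₁ (D₁ f) (X s) (Y s)) (X t - X s)‖ ≤
      C * (d * |t - s| ^ α) * (c * |t - s| ^ α) :=
    (ContinuousLinearMap.le_opNorm _ _).trans (mul_le_mul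
      ((h.d₂₁₁.lip_snd h.convex_snd h.snd₂ xs ys yt).trans
        (mul_le_mul_of_nonneg_left (hY.bound s hs t ht) hC)) (hX.bound s hs t ht)
      (norm_nonneg _) (by positivity))
  have b3 := (norm_taylor_one_le h.convex_snd (fun z _ => hasFDerivAt_D₂ h.snd₁ (X s) z) ys hC
    (fun z hz => h.d₂₂₁.lip_snd h.convex_snd h.snd₁₂ xs ys hz) yt).trans
    (mul_le_mul_of_nonneg_left (hY.sq_le hs ht) hC)
  have b4 : ‖D₂ (D₁ f) (X s) (Y s) (Y t - Y s - D₁ f (X s) (Ydot s) (X t - X s))‖ ≤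
      C * (e * |t - s| ^ (2 * α)) :=
    (ContinuousLinearMap.le_opNorm _ _).trans (mul_le_mul (h.d₂₁ _ xs _ ys) (hR s hs t ht)
      (norm_nonneg _) hC)
  -- Expand in $X$ with $Y_t$ frozen, move the coefficient $D_{11}f$ from $Y_t$ to $Y_s$, expand in
  -- $Y$ with $X_s$ frozen, and replace $Y_{s,t}$ by its controlled approximation.
  have e1 : incr (fun r => D₁ f (X r) (Y r)) s t - compDeriv f X Y Ydot s (incr X s t) =
      (D₁ f (X t) (Y t) - D₁ f (X s) (Y t) - D₁ (D₁ f) (X s) (Y t) (X t - X s)) +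
      (D₁ (D₁ f) (X s) (Y t) - D₁ (D₁ f) (X s) (Y s)) (X t - X s) +
      (D₁ f (X s) (Y t) - D₁ f (X s) (Y s) - D₂ (D₁ f) (X s) (Y s) (Y t - Y s)) +
      D₂ (D₁ f) (X s) (Y s) (Y t - Y s - D₁ f (X s) (Ydot s) (X t - X s)) := by
    simp only [incr, compDeriv, add_apply, sub_apply, ContinuousLinearMap.comp_apply, map_sub]
    abel
  beta_reduce
  rw [e1]
  refine (norm_add_le_of_le (norm_add_le_of_le (norm_add_le_of_le b1 b2) b3) b4).trans ?_
  rw [rpow_two_mul (abs_nonneg _)]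
  exact le_of_eq (by ring)

theorem LocallyRegular.taylor_two_fst (h : LocallyRegular U B C f)
    {x x' y : V} (hx : x ∈ U)
    (hx' : x' ∈ U) (hy : y ∈ B) :
    ‖f x' y - f x y - D₁ f x y (x' - x) - (1 / 2 : ℝ) • D₁ (D₁ f) x y (x' - x) (x' - x)‖ ≤
      C * ‖x' - x‖ ^ 3 :=
  norm_taylor_two_le h.convex_fst (fun z => hasFDerivAt_D₁ h.fst₀ z y)
    (fun z => hasFDerivAt_D₁ h.fst₁ z y) hx h.nonneg
    (fun _ hz => h.d₁₁₁.lip_fst h.convex_fst h.fst₂ hx hz hy) hx'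

theorem hasFDerivAt_clm_apply_of_flip {F G H : Type*} [NormedAddCommGroup F] [NormedSpace ℝ F]
    [NormedAddCommGroup G] [NormedSpace ℝ G] [NormedAddCommGroup H] [NormedSpace ℝ H]
    {A : F → G →L[ℝ] H} {M : G →L[ℝ] F →L[ℝ] H} {x : F} (h : HasFDerivAt A M.flip x) (w : G) :
    HasFDerivAt (fun z => A z w) (M w) x := by
  simpa using h.clm_apply (hasFDerivAt_const w x)

theorem LocallyRegular.taylor_two_D₂ (h : LocallyRegular U B C f)
    {β : Fin 3 → ℝ}
    (hβ : ∀ k, 0 ≤ β k) (hf : MemCloc 3 2 β f) {x x' y : V} (hx : x ∈ U)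
    (hx' : x' ∈ U) (hy : y ∈ B) {w : V} (hw : ‖w‖ ≤ C) :
    ‖D₂ f x' y w - D₂ f x y w - D₂ (D₁ f) x y w (x' - x) -
      (1 / 2 : ℝ) • D₂ (D₁ (D₁ f)) x y w (x' - x) (x' - x)‖ ≤ C ^ 2 * ‖x' - x‖ ^ 3 := by
  refine norm_taylor_two_le h.convex_fst
    (fun z => hasFDerivAt_clm_apply_of_flip (hf.hasFDerivAt_D₂ hβ z y) w)
    (fun z => hasFDerivAt_clm_apply_of_flip (hf.hasFDerivAt_D₂₁ hβ z y) w) hx (sq_nonneg C)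
    (fun z hz => ?_) hx'
  rw [← sub_apply]
  have hC := h.nonneg
  calc _ ≤ C * ‖z - x‖ * C := (ContinuousLinearMap.le_opNorm _ _).trans
        (mul_le_mul (h.d₂₁₁₁.lip_D₂ h.convex_fst h.convex_snd h.isOpen_snd h.nonneg h.fst₂ h.snd₃
          h.snd₂ hx hz hy) hw (norm_nonneg _) (by positivity))
    _ = _ := by ring

theorem MemCloc.fderiv_compH {β : Fin 3 → ℝ} (hβ : ∀ k, 0 ≤ β k) (hf : MemCloc 3 2 β f) (x y : V) :
    fderiv ℝ (compH f x y) = compHDeriv f x y :=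
  funext fun z => (hf.hasFDerivAt_compH hβ x y z).fderiv

end Composition

/-! ### The comparison of the summands. -/

section Main

variable {V : Type u} [NormedAddCommGroup V] [NormedSpace ℝ V] [CompleteSpace V]
  {T α C c c₂ d e : ℝ} {U B : Set V} {β : Fin 3 → ℝ} {f : V → V → V} {X Y Ydot : ℝ → V}
  {XX : ℝ → ℝ → ProjTensor V}

theorem exists_locallyRegular (hβ : ∀ k, 0 ≤ β k) (hf : MemCloc 3 2 β f) (hα : 0 < α)
    (hX : IsHolder T α X) (R : ℝ) :
    ∃ U C c, LocallyRegular U (Metric.ball 0 R) C f ∧ HolderPathIn T α c U X := by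
  obtain ⟨c, hc, hXc⟩ := hX.exists_bound
  obtain ⟨K, hK, hKc, hXK⟩ :=
    exists_isCompact_convex_superset (isCompact_Icc.image_of_continuousOn (hXc.continuousOn hα))
  obtain ⟨r, hr, C, hC, hb⟩ := hf.exists_derivBounds hβ hK R
  exact ⟨Metric.thickening r K, C, c, ⟨hb, hf.partialDifferentiable, hKc.thickening r,
    convex_ball _ _, Metric.isOpen_ball, hC⟩, hXc,
    fun t ht => Metric.self_subset_thickening hr K (hXK ⟨t, ht, rfl⟩), hc⟩

theorem LocallyRegular.almostAdditive_compH (h : LocallyRegular U B C f) (hα : 0 ≤ α)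
    (hβ : ∀ k, 0 ≤ β k) (hf : MemCloc 3 2 β f) (hX : IsRoughPath T α X XX)
    (hXc : HolderPathIn T α c U X) (hc₂ : 0 ≤ c₂) (hXX : HolderBound T (2 * α) c₂ XX) {x y : V}
    (hx : x ∈ B) (hy : y ∈ B) :
    AlmostAdditive T (3 * α) (4 * C ^ 2 * c ^ 2 * c + 4 * C ^ 2 * c * c₂)
      (linearSummand X XX (fun r => compH f x y (X r)) (fun r => compHDeriv f x y (X r))) := by
  have hc := hXc.nonneg
  exact hX.almostAdditive_linearSummand hα (by positivity) (by positivity) hc hc₂ hXc.bound hXX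
    (h.remainder_compH hXc hx hy (hf.hasFDerivAt_compH hβ x y)) (h.holder_compHDeriv hXc hx hy)

theorem LocallyRegular.almostAdditive_compA (h : LocallyRegular U B C f) (hα : 0 ≤ α)
    (hX : IsRoughPath T α X XX) (hXc : HolderPathIn T α c U X) (hc₂ : 0 ≤ c₂)
    (hXX : HolderBound T (2 * α) c₂ XX) {x y : V} (hx : x ∈ B) (hy : y ∈ B) :
    AlmostAdditive T (3 * α) (2 * C ^ 2 * c * (c ^ 2 + 2 * c₂))
      (youngSummand X XX (compA f X x y)) := by
  have hc := hXc.nonneg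
  exact hX.almostAdditive_youngSummand hα (by positivity) hc hc₂ hXc.bound hXX
    (h.holder_compA hXc hx hy) fun r v w => h.D₂₁₁_symm _ _ _ v w

/-- The summand of the nonlinear rough integral agrees, up to order `3α`, with those of the
linear rough integral and the Young integral. -/
theorem LocallyRegular.exists_norm_nonlinearSummand_sub_le (h : LocallyRegular U B C f)
    (hα : 1 < 3 * α) (hβ : ∀ k, 0 ≤ β k) (hf : MemCloc 3 2 β f) (hX : IsRoughPath T α X XX)
    (hXc : HolderPathIn T α c U X) (hc₂ : 0 ≤ c₂) (hXX : HolderBound T (2 * α) c₂ XX)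
    (hY : ∀ r ∈ Set.Icc 0 T, Y r ∈ B) (hYd : ∀ r ∈ Set.Icc 0 T, Ydot r ∈ B) :
    ∃ M, ∀ s t, 0 ≤ s → s ≤ t → t ≤ T →
      ‖nonlinearSummand (compW f X) (compWW f X XX) Y Ydot s t -
        (linearSummand X XX (fun r => D₁ f (X r) (Y r)) (compDeriv f X Y Ydot) s t +
          (1 / 2 : ℝ) • youngSummand X XX (fun r => D₁ (D₁ f) (X r) (Y r)) s t)‖ ≤
        M * (t - s) ^ (3 * α) := by
  have hα0 : 0 ≤ α := by linarith
  have hC := h.nonneg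
  have hc := hXc.nonneg
  refine ⟨C * c ^ 3 + sewingConst (3 * α) * (4 * C ^ 2 * c ^ 2 * c + 4 * C ^ 2 * c * c₂) +
    1 / 2 * (sewingConst (3 * α) * (2 * C ^ 2 * c * (c ^ 2 + 2 * c₂))) + C ^ 2 * c ^ 3,
    fun s t hs hst ht => ?_⟩
  have hs' : s ∈ Set.Icc 0 T := ⟨hs, hst.trans ht⟩
  have ht' : t ∈ Set.Icc 0 T := ⟨hs.trans hst, ht⟩
  have xs := hXc.mem s hs'
  have xt := hXc.mem t ht'
  have hx := hYd s hs'
  have hy := hY s hs'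
  have h3 := hXc.cube_le hs' ht'
  rw [abs_of_nonneg (sub_nonneg.2 hst)] at h3
  set x := Ydot s with hxdef
  set y := Y s with hydef
  have b1 := (h.taylor_two_fst xs xt hy).trans (mul_le_mul_of_nonneg_left h3 hC)
  have b2 := ((h.almostAdditive_compH hα0 hβ hf hX hXc hc₂ hXX hx hy).sumConverges hα
    (by positivity) hs hst ht).2
  have b3 := ((h.almostAdditive_compA hα0 hX hXc hc₂ hXX hx hy).sumConverges hα
    (by positivity) hs hst ht).2
  have b4 := (h.taylor_two_D₂ hβ hf xs xt hy (h.d₀ _ xs _ hx)).trans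
    (mul_le_mul_of_nonneg_left h3 (sq_nonneg C))
  -- An exact identity: the difference is two Taylor remainders and two sewing errors, bounded by
  -- `b1` to `b4`. All other terms cancel once the brackets are expanded.
  have key : nonlinearSummand (compW f X) (compWW f X XX) Y Ydot s t -
        (linearSummand X XX (fun r => D₁ f (X r) (Y r)) (compDeriv f X Y Ydot) s t +
          (1 / 2 : ℝ) • youngSummand X XX (fun r => D₁ (D₁ f) (X r) (Y r)) s t) =
      (f (X t) y - f (X s) y - D₁ f (X s) y (X t - X s) -
        (1 / 2 : ℝ) • D₁ (D₁ f) (X s) y (X t - X s) (X t - X s)) +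
      (sumLimit (linearSummand X XX (fun r => compH f x y (X r))
          (fun r => compHDeriv f x y (X r))) s t -
        linearSummand X XX (fun r => compH f x y (X r)) (fun r => compHDeriv f x y (X r)) s t) +
      (1 / 2 : ℝ) • (sumLimit (youngSummand X XX (compA f X x y)) s t -
        youngSummand X XX (compA f X x y) s t) -
      (D₂ f (X t) y (f (X s) x) - D₂ f (X s) y (f (X s) x) -
        D₂ (D₁ f) (X s) y (f (X s) x) (X t - X s) -
        (1 / 2 : ℝ) • D₂ (D₁ (D₁ f)) (X s) y (f (X s) x) (X t - X s) (X t - X s)) := by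
    simp only [nonlinearSummand, compWW, compIntegral, linearRoughIntegral, youngIntegral,
      hf.fderiv_compH hβ, ← hxdef, ← hydef, compW]
    simp only [linearSummand, youngSummand, tensorLift_bracket, compHDeriv, compDeriv, compH,
      compA, tensorLift_add, ← hxdef, ← hydef, incr, sub_apply, smul_sub, smul_smul]
    norm_num
    abel
  rw [key]
  refine (norm_sub_le_of_le (norm_add_le_of_le (norm_add_le_of_le b1 b2)
    ((norm_smul_le _ _).trans (mul_le_mul_of_nonneg_left b3 (norm_nonneg _)))) b4).trans ?_
  rw [Real.norm_of_nonneg (by norm_num : (0 : ℝ) ≤ 1 / 2)]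
  exact le_of_eq (by ring)

end Main

end NonlinearRough

/-! ### The theorem. -/

open NonlinearRough in
theorem theorem5p1 {V : Type u} [NormedAddCommGroup V] [NormedSpace ℝ V] [CompleteSpace V]
    [TopologicalSpace.SeparableSpace V]
    (T : ℝ) (hT : 0 < T) (α : ℝ) (hα : 1 / 3 < α) (hα' : α ≤ 1 / 2)
    (β : Fin 3 → ℝ) (hβ : ∀ k, 0 ≤ β k)
    (f : V → V → V) (hf : MemCloc 3 2 β f)
    (X : ℝ → V) (XX : ℝ → ℝ → ProjTensor V) (hX : IsRoughPath T α X XX)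
    (Y Ydot : ℝ → V) (hY : IsNonlinearControlled T α (compW f X) Y Ydot) :
    -- the integrals that define `𝕎` exist
    (∀ x y : V,
      Differentiable ℝ (compH f x y) ∧
      IsControlled T α X (fun r => compH f x y (X r)) (fun r => fderiv ℝ (compH f x y) (X r)) ∧
      ∀ s t : ℝ, 0 ≤ s → s ≤ t → t ≤ T →
        SumConverges (linearSummand X XX (fun r => compH f x y (X r))
          (fun r => fderiv ℝ (compH f x y) (X r))) s t ∧
        SumConverges (youngSummand X XX (compA f X x y)) s t) ∧
    -- `(Y, D₁f(X, Ydot))` is controlled by `X`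
    IsControlled T α X Y (fun r => D₁ f (X r) (Ydot r)) ∧
    -- `D₁f(X, Y)` is controlled by `X`, with Gubinelli derivative `D₁₁f(X,Y) + D₂₁f(X,Y) Y'`
    IsControlled T α X (fun r => D₁ f (X r) (Y r))
      (fun r => D₁ (D₁ f) (X r) (Y r) +
        (D₂ (D₁ f) (X r) (Y r)).comp (D₁ f (X r) (Ydot r))) ∧
    -- the three integrals exist and satisfy the identity
    ∀ s t : ℝ, 0 ≤ s → s ≤ t → t ≤ T →
      SumConverges (nonlinearSummand (compW f X) (compWW f X XX) Y Ydot) s t ∧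
      SumConverges (linearSummand X XX (fun r => D₁ f (X r) (Y r))
        (fun r => D₁ (D₁ f) (X r) (Y r) +
          (D₂ (D₁ f) (X r) (Y r)).comp (D₁ f (X r) (Ydot r)))) s t ∧
      SumConverges (youngSummand X XX (fun r => D₁ (D₁ f) (X r) (Y r))) s t ∧
      nonlinearRoughIntegral (compW f X) (compWW f X XX) Y Ydot s t =
        linearRoughIntegral X XX (fun r => D₁ f (X r) (Y r))
          (fun r => D₁ (D₁ f) (X r) (Y r) +
            (D₂ (D₁ f) (X r) (Y r)).comp (D₁ f (X r) (Ydot r))) s t +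
        (1 / 2 : ℝ) • youngIntegral X XX (fun r => D₁ (D₁ f) (X r) (Y r)) s t := by
  have hα0 : 0 < α := by linarith
  have hα1 : 1 < 3 * α := by linarith
  obtain ⟨c₂, hc₂, hXX⟩ := hX.exists_bound
  simp only [hf.fderiv_compH hβ]
  refine ⟨fun x y => ⟨fun z => (hf.hasFDerivAt_compH hβ x y z).differentiableAt, ?_⟩, ?_⟩
  · obtain ⟨U, C, c, h, hXc⟩ := exists_locallyRegular hβ hf hα0 hX.holder (‖x‖ + ‖y‖ + 1)
    have hC := h.nonneg
    have hc := hXc.nonneg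
    have hx : x ∈ Metric.ball 0 (‖x‖ + ‖y‖ + 1) :=
      mem_ball_zero_iff.2 (by linarith [norm_nonneg y])
    have hy : y ∈ Metric.ball 0 (‖x‖ + ‖y‖ + 1) :=
      mem_ball_zero_iff.2 (by linarith [norm_nonneg x])
    refine ⟨h.isControlled_compH hXc hx hy (hf.hasFDerivAt_compH hβ x y),
      fun s t hs hst ht => ⟨?_, ?_⟩⟩
    · exact ((h.almostAdditive_compH hα0.le hβ hf hX hXc hc₂ hXX hx hy).sumConverges hα1
        (by positivity) hs hst ht).1
    · exact ((h.almostAdditive_compA hα0.le hX hXc hc₂ hXX hx hy).sumConverges hα1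
        (by positivity) hs hst ht).1
  obtain ⟨d, hd, hYb⟩ := hY.holder.exists_bound
  obtain ⟨d', hd', hYdb⟩ := hY.holder_dot.exists_bound
  obtain ⟨e, he, hN⟩ := hY.remainder.exists_bound fun s _ => by simp [incr]
  -- The radius is chosen so that one open ball contains both $Y$ and $\dot Y$ on $[0,T]$.
  obtain ⟨U, C, c, h, hXc⟩ := exists_locallyRegular hβ hf hα0 hX.holder
    (‖Y 0‖ + d * T ^ α + (‖Ydot 0‖ + d' * T ^ α) + 1)
  have hTα : 0 ≤ T ^ α := by positivity
  have hYc : HolderPathIn T α d (Metric.ball 0 _) Y := ⟨hYb, fun r hr => mem_ball_zero_iff.2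
    (lt_of_le_of_lt (hYb.bounded hα0.le hd r hr) (lt_add_of_le_of_pos
      (le_add_of_nonneg_right (show 0 ≤ ‖Ydot 0‖ + d' * T ^ α by positivity)) one_pos)), hd⟩
  have hYdc : HolderPathIn T α d' (Metric.ball 0 _) Ydot := ⟨hYdb, fun r hr => mem_ball_zero_iff.2
    (lt_of_le_of_lt (hYdb.bounded hα0.le hd' r hr) (lt_add_of_le_of_pos
      (le_add_of_nonneg_left (show 0 ≤ ‖Y 0‖ + d * T ^ α by positivity)) one_pos)), hd'⟩
  have hC := h.nonneg
  have hc := hXc.nonneg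
  have hR := h.remainder_solution hXc hYdc hN
  have hR₁ := h.remainder_D₁ hXc hYc hR
  have hD := h.holder_compDeriv hXc hYc hYdc
  refine ⟨⟨hY.holder, (h.holder_D₁ hXc hYdc).isHolder₂, hR.isHolder₂⟩,
    ⟨(h.holder_D₁ hXc hYc).isHolder₂, hD.isHolder₂, hR₁.isHolder₂⟩, fun s t hs hst ht => ?_⟩
  have hlin := ((hX.almostAdditive_linearSummand hα0.le (by positivity) (by positivity) hc hc₂
    hXc.bound hXX hR₁ hD).sumConverges hα1 (by positivity) hs hst ht).1
  have hyoung := ((hX.almostAdditive_youngSummand hα0.le (by positivity) hc hc₂ hXc.bound hXX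
    (h.holder_D₁₁ hXc hYc) fun r v w => h.D₁₁_symm _ _ v w).sumConverges hα1
    (by positivity) hs hst ht).1
  obtain ⟨M, hM⟩ := h.exists_norm_nonlinearSummand_sub_le hα1 hβ hf hX hXc hc₂ hXX hYc.mem hYdc.mem
  -- Adding the vanishing difference to the two convergent right-hand sums gives both the existence
  -- and the value of the nonlinear integral.
  have hsum := (hasSumLimit_of_norm_le hα1 hM hs ht).add
    ((hlin.hasSumLimit hst).add ((hyoung.hasSumLimit hst).const_smul (1 / 2)))
  simp only [sub_add_cancel, zero_add] at hsum
  exact ⟨⟨_, hsum⟩, hlin, hyoung, hsum.sumLimit_eq hst⟩
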